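/- Let $n\ge 2$ and $0\le d\le n$, and let $\widetilde G^n_d$ be the oriented Grassmannian of oriented $d$-dimensional linear subspaces of $\mathbb R^n$, regarded as classes of ordered linearly independent $d$-frames $(u_1,\dots,u_d)$ modulo changes of basis of positive determinant. An (oriented) $d$-varifold is a nonnegative finite Radon measure on $\mathbb R^n\times\widetilde G^n_d$; the weight $|\mu|$ of a varifold $\mu$ is its marginal on $\mathbb R^n$. Let $V$ be a Hilbert space of vector fields $\mathbb R^n\to\mathbb R^n$ continuously embedded in $C^2_0(\mathbb R^n,\mathbb R^n)$, the space of $C^2$ fields that vanish at infinity together with their derivatives of order one and two. For $v\in L^2([0,1],V)$ let $\varphi^v$ be its flow, $\varphi^v_t(x)=x+\int_0^t v_s(\varphi^v_s(x))\,ds$ for $t\in[0,1]$, $x\in\mathbb R^n$. Let $k$ be a positive definite kernel on $\mathbb R^n\times\widetilde G^n_d$ and let $W$ be its reproducing kernel Hilbert space. Suppose that $k$ is $C_0$-universal (that is, $W$ is contained and dense in $C_0(\mathbb R^n\times\widetilde G^n_d)$ for the sup-norm), and that $W$ is continuously embedded in $C_0^1(\mathbb R^n\times\widetilde G^n_d)$,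 the space of $C^1$ functions that vanish at infinity together with their differential. For a linear form $T$ on $W$ let $\|T\|_{W^*}=\sup\{(T|\omega):\omega\in W,\ \|\omega\|_W\le 1\}$. Let $\mu,\mu'$ be $d$-varifolds such that $\operatorname{supp}(\mu)\subset K$ for some compact $K\subset\mathbb R^n\times\widetilde G^n_d$, and let $\gamma,\lambda>0$. For $v\in L^2([0,1],V)$ and a real-valued $\alpha\in L^2(|\mu|)$ put $$E(v,\alpha)=\frac12\int_0^1\|v_t\|_V^2\,dt+\frac\gamma2\int_{\mathbb R^n}(\alpha(x)-1)^2\,d|\mu|(x)+\frac\lambda2\big\|(\varphi^v_1)_\#(\alpha\mu)-\mu'\big\|_{W^*}^2,$$ where $$\big((\varphi)_\#(\alpha\mu)\,\big|\,\omega\big)=\int \alpha(x)\,\omega\big(\varphi(x),d_x\varphi\cdot U\big)\,J_U\varphi(x)\,d\mu(x,U),\qquad (\mu'|\omega)=\int\omega\,d\mu',$$ $d_x\varphi\cdot U$ is the oriented subspace spanned by the image under $d_x\varphi$ of a frame of $U$, and $J_U\varphi(x)=\sqrt{\det(d_x\varphi(u_i)\cdot d_x\varphi(u_j))_{i,j}}$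 for any orthonormal frame $(u_i)$ of $U$. Then every $v\in L^2([0,1],V)$ has a unique flow on $[0,1]$, and there exists $(v,\alpha)\in L^2([0,1],V)\times L^2(|\mu|)$ at which $E$ attains its infimum over $L^2([0,1],V)\times L^2(|\mu|)$. Likewise, the infimum of $E$ over the pairs $(v,\alpha)$ with $\alpha\ge 0$ $|\mu|$-almost everywhere is attained by such a pair. -/

import Mathlib

open MeasureTheory Set Filter Topology
open scoped ZeroAtInfty

noncomputable section

namespace VarifoldMetamorphosis

/-- The ambient Euclidean space `ℝⁿ`. -/
abbrev Euc (n : ℕ) : Type := EuclideanSpace ℝ (Fin n)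

/-! ### The oriented Grassmannian -/

/-- Ordered frames: linearly independent `d`-tuples of vectors of `ℝⁿ`. -/
abbrev Frame (n d : ℕ) : Type := {u : Fin d → Euc n // LinearIndependent ℝ u}

/-- Two frames span the same oriented subspace iff the change of basis between them has positive
determinant. -/
def SameOrientedSpan {n d : ℕ} (u w : Frame n d) : Prop :=
  ∃ A : Matrix (Fin d) (Fin d) ℝ, 0 < A.det ∧ ∀ i, w.1 i = ∑ j, A i j • u.1 j

theorem sum_smul_comp {n d : ℕ} (A B : Matrix (Fin d) (Fin d) ℝ) (u : Fin d → Euc n) (i : Fin d) :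
    ∑ j, B i j • ∑ k, A j k • u k = ∑ k, (B * A) i k • u k := by
  simp only [Finset.smul_sum, smul_smul, Matrix.mul_apply, Finset.sum_smul]
  exact Finset.sum_comm

instance frameSetoid (n d : ℕ) : Setoid (Frame n d) where
  r := SameOrientedSpan
  iseqv :=
    { refl := fun u => ⟨1, by simp, fun i => by simp [Matrix.one_apply]⟩
      symm := by
        rintro u w ⟨A, hA, h⟩
        refine ⟨A⁻¹, ?_, fun i => ?_⟩
        · rw [Matrix.det_nonsing_inv, Ring.inverse_eq_inv']
          positivity
        · simp only [h]
          rw [sum_smul_comp, Matrix.nonsing_inv_mul _ (isUnit_iff_ne_zero.mpr hA.ne')]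
          simp [Matrix.one_apply]
      trans := by
        rintro u w z ⟨A, hA, h⟩ ⟨B, hB, h'⟩
        refine ⟨B * A, ?_, fun i => ?_⟩
        · rw [Matrix.det_mul]
          positivity
        · rw [h' i]
          simp only [h]
          rw [sum_smul_comp] }

/-- The oriented Grassmannian of oriented `d`-dimensional linear subspaces of `ℝⁿ`, as classes of
frames, with the quotient topology. -/
def OrientedGrassmannian (n d : ℕ) : Type := Quotient (frameSetoid n d)

instance (n d : ℕ) : TopologicalSpace (OrientedGrassmannian n d) :=
  inferInstanceAs (TopologicalSpace (Quotient (frameSetoid n d)))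

instance (n d : ℕ) : MeasurableSpace (OrientedGrassmannian n d) :=
  borel (OrientedGrassmannian n d)

instance (n d : ℕ) : BorelSpace (OrientedGrassmannian n d) := ⟨rfl⟩

/-- The oriented subspace spanned by a frame. -/
def orientedSpan {n d : ℕ} (u : Frame n d) : OrientedGrassmannian n d :=
  Quotient.mk (frameSetoid n d) u

/-- The image of a frame under an injective linear map. -/
def Frame.map {n d : ℕ} (L : Euc n →L[ℝ] Euc n) (hL : Function.Injective L) (u : Frame n d) :
    Frame n d :=
  ⟨fun i => L (u.1 i), u.2.map' L.toLinearMap (LinearMap.ker_eq_bot.mpr hL)⟩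

open Classical in
/-- The transported oriented subspace `L · U`, for an injective linear map `L` (in particular for
the differential of a diffeomorphism); for other `L` it is not meaningful and set to `U`. -/
def OrientedGrassmannian.map {n d : ℕ} (L : Euc n →L[ℝ] Euc n) (U : OrientedGrassmannian n d) :
    OrientedGrassmannian n d :=
  if hL : Function.Injective L then
    Quotient.map (Frame.map L hL)
      (by
        rintro u w ⟨A, hA, h⟩
        exact ⟨A, hA, fun i => by simp [Frame.map, h i]⟩) U
  else U

theorem OrientedGrassmannian.map_orientedSpan {n d : ℕ} (L : Euc n →L[ℝ] Euc n)
    (hL : Function.Injective L) (u : Frame n d) :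
    (orientedSpan u).map L = orientedSpan (u.map L hL) :=
  dif_pos hL

theorem det_gram_change {n d : ℕ} (A : Matrix (Fin d) (Fin d) ℝ) (u w : Fin d → Euc n)
    (h : ∀ i, w i = ∑ j, A i j • u j) :
    (Matrix.gram ℝ w).det = A.det ^ 2 * (Matrix.gram ℝ u).det := by
  have : Matrix.gram ℝ w = A * Matrix.gram ℝ u * A.transpose := by
    ext i j
    simp only [Matrix.gram_apply, h, Matrix.mul_apply, Matrix.transpose_apply, sum_inner, inner_sum,
      real_inner_smul_left, real_inner_smul_right, Finset.sum_mul]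
    exact Finset.sum_congr rfl fun a _ => Finset.sum_congr rfl fun b _ => by ring
  rw [this, Matrix.det_mul, Matrix.det_mul, Matrix.det_transpose]
  ring

/-- The Jacobian of the linear map `L` along the oriented subspace `U`: the factor
`√(det (L uᵢ · L uⱼ)) / √(det (uᵢ · uⱼ))` by which `L` changes `d`-volume, for any frame `u` of `U`
(the denominator is `1` when `u` is orthonormal). -/
def jacobianAlong {n d : ℕ} (L : Euc n →L[ℝ] Euc n) (U : OrientedGrassmannian n d) : ℝ :=
  Quotient.lift
    (fun u : Frame n d =>
      √(Matrix.gram ℝ (fun i => L (u.1 i))).det / √(Matrix.gram ℝ u.1).det)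
    (by
      rintro u w ⟨A, hA, h⟩
      have h2 : ∀ i, L (w.1 i) = ∑ j, A i j • L (u.1 j) := fun i => by simp [h i]
      have e1 := det_gram_change A u.1 w.1 h
      have e2 := det_gram_change A (fun i => L (u.1 i)) (fun i => L (w.1 i)) h2
      simp only [e1, e2]
      rw [Real.sqrt_mul (by positivity), Real.sqrt_mul (by positivity), Real.sqrt_sq hA.le,
        mul_div_mul_left _ _ hA.ne']) U

theorem jacobianAlong_of_orthonormal {n d : ℕ} (L : Euc n →L[ℝ] Euc n) (u : Frame n d)
    (hu : Orthonormal ℝ u.1) :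
    jacobianAlong L (orientedSpan u) =
      √(Matrix.of fun i j => inner ℝ (L (u.1 i)) (L (u.1 j))).det := by
  have : Matrix.gram ℝ u.1 = 1 := by
    ext i j
    rw [Matrix.gram_apply, orthonormal_iff_ite.mp hu i j, Matrix.one_apply]
  change √(Matrix.gram ℝ (fun i => L (u.1 i))).det / √(Matrix.gram ℝ u.1).det = _
  rw [this]
  simp [Matrix.gram]

/-! ### Function spaces -/

open Classical in
/-- The lift of a function on `ℝⁿ × G̃ⁿ_d` to pairs (point, frame); it is only meaningful on the open
set of pairs whose second component is linearly independent. -/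
def frameLift {n d : ℕ} (ω : Euc n × OrientedGrassmannian n d → ℝ) :
    Euc n × (Fin d → Euc n) → ℝ :=
  fun p => if h : LinearIndependent ℝ p.2 then ω (p.1, orientedSpan ⟨p.2, h⟩) else 0

/-- `ω ∈ C₀¹(ℝⁿ × G̃ⁿ_d)`: a `C¹` function vanishing at infinity together with its differential.
The frame space is open in `(ℝⁿ)ᵈ` and projects onto the Grassmannian by a surjective submersion, so
`ω` is `C¹` on the manifold iff its lift is `C¹`; at an orthonormal frame `u` of `U` the norm of the
differential of the lift is, up to constants, the norm of the differential of `ω` at `(x, U)` for the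
canonical metric. As the Grassmannian is compact, going to infinity means `‖x‖ → ∞`. -/
structure IsC01 {n d : ℕ} (ω : Euc n × OrientedGrassmannian n d → ℝ) : Prop where
  zero_at_infty : ∃ f : C₀(Euc n × OrientedGrassmannian n d, ℝ), ⇑f = ω
  contDiffOn : ContDiffOn ℝ 1 (frameLift ω) {p | LinearIndependent ℝ p.2}
  fderiv_zero_at_infty : ∀ ε > 0, ∃ R : ℝ, ∀ (x : Euc n) (u : Fin d → Euc n),
    Orthonormal ℝ u → R ≤ ‖x‖ → ‖fderiv ℝ (frameLift ω) (x, u)‖ ≤ ε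

/-- The Hilbert space `W` of functions is continuously embedded in `C₀¹(ℝⁿ × G̃ⁿ_d)`. -/
def EmbedsInC01 (n d : ℕ) (W : Type*) [NormedAddCommGroup W] [InnerProductSpace ℝ W]
    [RKHS ℝ W (Euc n × OrientedGrassmannian n d) ℝ] : Prop :=
  ∃ c : ℝ, ∀ ω : W, IsC01 (⇑ω) ∧ (∀ p, |ω p| ≤ c * ‖ω‖) ∧
    ∀ (x : Euc n) (u : Fin d → Euc n), Orthonormal ℝ u →
      ‖fderiv ℝ (frameLift ⇑ω) (x, u)‖ ≤ c * ‖ω‖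

/-- The Hilbert space `V` of vector fields is continuously embedded in `C₀²(ℝⁿ, ℝⁿ)`, the `C²` vector
fields vanishing at infinity together with their derivatives of order one and two. -/
def EmbedsInC02 (n : ℕ) (V : Type*) [NormedAddCommGroup V] [InnerProductSpace ℝ V]
    [RKHS ℝ V (Euc n) (Euc n)] : Prop :=
  ∃ c : ℝ, ∀ u : V, ContDiff ℝ 2 (⇑u) ∧ ∀ i ≤ 2,
    Tendsto (iteratedFDeriv ℝ i ⇑u) (cocompact (Euc n)) (𝓝 0) ∧
    ∀ x, ‖iteratedFDeriv ℝ i (⇑u) x‖ ≤ c * ‖u‖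

/-- `k` is the reproducing kernel of the Hilbert space `W` of real functions on `X`, that is, `W` is
the RKHS of `k`. -/
def IsReproducingKernel {X : Type*} (k : X → X → ℝ) (W : Type*) [NormedAddCommGroup W]
    [InnerProductSpace ℝ W] [RKHS ℝ W X ℝ] : Prop :=
  ∀ q : X, ∃ kq : W, (∀ p, kq p = k p q) ∧ ∀ f : W, inner ℝ f kq = f q

/-- The kernel `k` with RKHS `W` is `C₀`-universal: `W` consists of functions of `C₀(X)` and is dense
in `C₀(X)` for the sup-norm. -/
def IsC0Universal {X : Type*} [TopologicalSpace X] (k : X → X → ℝ) (W : Type*)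
    [NormedAddCommGroup W] [InnerProductSpace ℝ W] [RKHS ℝ W X ℝ] : Prop :=
  IsReproducingKernel k W ∧ (∀ ω : W, ∃ f : C₀(X, ℝ), ⇑f = ⇑ω) ∧
    Dense {f : C₀(X, ℝ) | ∃ ω : W, ⇑ω = ⇑f}

/-! ### Time-dependent vector fields and their flows -/

/-- `L²([0,1], V)`. -/
abbrev TimeL2 (V : Type*) [NormedAddCommGroup V] : Type _ :=
  Lp V 2 (volume.restrict (Icc (0 : ℝ) 1))

/-- `φ` is the flow of `v`: `φ_t(x) = x + ∫₀ᵗ v_s(φ_s(x)) ds` for all `t ∈ [0,1]`, `x ∈ ℝⁿ`. -/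
def IsFlow {n : ℕ} {V : Type*} [NormedAddCommGroup V] [InnerProductSpace ℝ V]
    [RKHS ℝ V (Euc n) (Euc n)] (v : TimeL2 V) (φ : ℝ → Euc n → Euc n) : Prop :=
  ∀ x, ContinuousOn (fun t => φ t x) (Icc 0 1) ∧
    ∀ t ∈ Icc (0 : ℝ) 1, φ t x = x + ∫ s in (0 : ℝ)..t, (v s) (φ s x)

open Classical in
/-- The flow `φ^v` of `v`. -/
def flow {n : ℕ} {V : Type*} [NormedAddCommGroup V] [InnerProductSpace ℝ V]
    [RKHS ℝ V (Euc n) (Euc n)] (v : TimeL2 V) : ℝ → Euc n → Euc n :=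
  if h : ∃ φ, IsFlow v φ then h.choose else fun _ x => x

/-! ### Varifolds as distributions, their transformation and the energy -/

/-- A (signed) varifold seen as a distribution, through its pairing with test functions on
`ℝⁿ × G̃ⁿ_d`. -/
abbrev Distr (n d : ℕ) : Type := (Euc n × OrientedGrassmannian n d → ℝ) → ℝ

/-- `(μ | ω) = ∫ ω dμ`. -/
def toDistr {n d : ℕ} (μ : Measure (Euc n × OrientedGrassmannian n d)) : Distr n d :=
  fun ω => ∫ p, ω p ∂μ

/-- `(α μ | ω) = ∫ α(x) ω(x, U) dμ(x, U)`. -/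
def rescale {n d : ℕ} (α : Euc n → ℝ) (μ : Measure (Euc n × OrientedGrassmannian n d)) :
    Distr n d :=
  fun ω => ∫ p, α p.1 * ω p ∂μ

/-- `(φ_# T | ω) = (T | (x, U) ↦ ω(φ(x), d_xφ · U) J_U φ(x))`. -/
def pushforward {n d : ℕ} (φ : Euc n → Euc n) (T : Distr n d) : Distr n d :=
  fun ω => T fun p => ω (φ p.1, p.2.map (fderiv ℝ φ p.1)) * jacobianAlong (fderiv ℝ φ p.1) p.2

/-- The dual norm `‖T‖_{W*} = sup {(T | ω) : ω ∈ W, ‖ω‖_W ≤ 1}`. -/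
def dualNorm {n d : ℕ} (W : Type*) [NormedAddCommGroup W] [InnerProductSpace ℝ W]
    [RKHS ℝ W (Euc n × OrientedGrassmannian n d) ℝ] (T : Distr n d) : ℝ :=
  sSup {r | ∃ ω : W, ‖ω‖ ≤ 1 ∧ r = T ⇑ω}

/-- The functional of the relaxed static `L²` problem,
`½ ∫₀¹ ‖v_t‖_V² dt + (γ/2) ∫ (α - 1)² d|μ| + (λ/2) ‖(φ₁^v)_# (α μ) - μ'‖_{W*}²`, for
`v ∈ L²([0,1], V)` and `α ∈ L²(|μ|)`; the weight measure `|μ|` is the first marginal of `μ`. -/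
def relaxedEnergy {n d : ℕ} {V : Type*} [NormedAddCommGroup V] [InnerProductSpace ℝ V]
    [RKHS ℝ V (Euc n) (Euc n)] (W : Type*) [NormedAddCommGroup W] [InnerProductSpace ℝ W]
    [RKHS ℝ W (Euc n × OrientedGrassmannian n d) ℝ]
    (γ lam : ℝ) (μ μ' : Measure (Euc n × OrientedGrassmannian n d))
    (q : TimeL2 V × Lp ℝ 2 μ.fst) : ℝ :=
  1 / 2 * ∫ t in Icc (0 : ℝ) 1, ‖q.1 t‖ ^ 2
    + γ / 2 * ∫ x, (q.2 x - 1) ^ 2 ∂μ.fst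
    + lam / 2 * dualNorm W (pushforward (flow q.1 1) (rescale q.2 μ) - toDistr μ') ^ 2

end VarifoldMetamorphosis

end

open VarifoldMetamorphosis

namespace VarifoldMetamorphosis

/-! ### Grönwall and Cauchy–Schwarz -/

/-! This is the direct method of the calculus of variations. The energy controls `‖v‖` and, because
the weight on the `α`-term is positive, `‖α - 1‖`. A minimizing sequence is therefore bounded in two
Hilbert spaces and has a weakly convergent subsequence (`exists_weakTendsto_subseq`). The constraint
`0 ≤ α` is weakly closed (`nonneg_of_weakTendsto`), so only weak lower semicontinuity remains.

The main point is that weak convergence of controls forces pointwise convergence of `φ₁` and `dφ₁`.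
The flow and its linearization both solve `ż = B(z) v`, with `B` Lipschitz in `z` and
operator-valued. Two solutions differ by a term that Grönwall absorbs and by terms along the fixed
limit curve `z`. The one containing the controls, `∫ B(z) (v' - v)`, is a continuous linear image of
`v' - v` in a finite-dimensional space, hence tends to zero (`IsSolution.tendsto`). The linearized
solution is the differential of the flow by a second-order Taylor estimate, and it is injective by
Grönwall run backwards, so the action on the Grassmannian is continuous along the flow.

The transported test functions then converge pointwise and boundedly, hence strongly in `L²(μ)`.
Paired with weakly convergent weights, this gives convergence of the defect on each fixed `ω`
(`tendsto_defect`). The dual norm is a supremum of such pairings and the other terms are squared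
Hilbert norms, so the energy is weakly lower semicontinuous (`weightedEnergy_le_of_weakTendsto`). -/

theorem le_of_le_add_mul_integral_of_continuous {w k : ℝ → ℝ} {K : ℝ} (hK : 0 ≤ K)
    (hw : Continuous w) (hk : Continuous k) (hk0 : ∀ t ∈ Icc (0 : ℝ) 1, 0 ≤ k t)
    (h : ∀ t ∈ Icc (0 : ℝ) 1, w t ≤ k t + K * ∫ s in (0 : ℝ)..t, w s) :
    ∀ t ∈ Icc (0 : ℝ) 1, w t ≤ k t + K * (Real.exp K * ∫ s in (0 : ℝ)..1, k s) := by
  have hP (t : ℝ) : HasDerivAt (fun t => ∫ s in (0 : ℝ)..t, w s) (w t) t :=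
    (hw.integral_hasStrictDerivAt 0 t).hasDerivAt
  have hk' (t : ℝ) : HasDerivAt (fun t => ∫ s in (0 : ℝ)..t, k s) (k t) t :=
    (hk.integral_hasStrictDerivAt 0 t).hasDerivAt
  have hexp (t : ℝ) : HasDerivAt (fun t => Real.exp (-(K * t))) (Real.exp (-(K * t)) * (-K)) t := by
    have := (((hasDerivAt_id t).const_mul K).neg).exp
    simpa using this
  have hQ (t : ℝ) := ((hexp t).mul (hP t)).sub (hk' t)
  -- The derivative is `exp(-Kt) (w - K ∫ w) - k ≤ (exp(-Kt) - 1) k ≤ 0`. The value at `0` is `0`,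
  -- so `∫₀ᵗ w ≤ exp(Kt) ∫₀ᵗ k`, which is substituted back into `h`.
  have hanti : AntitoneOn
      (fun t => Real.exp (-(K * t)) * (∫ s in (0 : ℝ)..t, w s) - ∫ s in (0 : ℝ)..t, k s)
      (Icc (0 : ℝ) 1) := by
    refine antitoneOn_of_hasDerivWithinAt_nonpos (convex_Icc 0 1)
      (fun t _ => (hQ t).continuousAt.continuousWithinAt)
      (fun t _ => (hQ t).hasDerivWithinAt) fun t ht => ?_
    rw [interior_Icc] at ht
    have ht' := Ioo_subset_Icc_self ht
    have h1 := h t ht'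
    have h2 : Real.exp (-(K * t)) ≤ 1 := Real.exp_le_one_iff.mpr (by
      have := mul_nonneg hK ht'.1
      linarith)
    have h3 := Real.exp_pos (-(K * t))
    nlinarith [mul_le_mul_of_nonneg_left h1 h3.le, mul_le_mul_of_nonneg_right h2 (hk0 t ht')]
  intro t ht
  have h0 := hanti (left_mem_Icc.mpr zero_le_one) ht ht.1
  simp only [mul_zero, neg_zero, Real.exp_zero, intervalIntegral.integral_same, sub_zero] at h0
  have hint : ∫ s in (0 : ℝ)..t, k s ≤ ∫ s in (0 : ℝ)..1, k s :=
    intervalIntegral.integral_mono_interval le_rfl ht.1 ht.2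
      ((ae_restrict_mem measurableSet_Ioc).mono fun s hs => hk0 s (Ioc_subset_Icc_self hs))
      (hk.intervalIntegrable _ _)
  have hint0 : 0 ≤ ∫ s in (0 : ℝ)..1, k s :=
    intervalIntegral.integral_nonneg zero_le_one hk0
  have h1 : ∫ s in (0 : ℝ)..t, w s ≤ Real.exp K * ∫ s in (0 : ℝ)..1, k s := by
    have e : Real.exp (K * t) * Real.exp (-(K * t)) = 1 := by rw [← Real.exp_add]; simp
    calc ∫ s in (0 : ℝ)..t, w s
        = Real.exp (K * t) * (Real.exp (-(K * t)) * ∫ s in (0 : ℝ)..t, w s) := by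
          rw [← mul_assoc, e, one_mul]
      _ ≤ Real.exp (K * t) * ∫ s in (0 : ℝ)..1, k s := by
          gcongr
          linarith
      _ ≤ Real.exp K * ∫ s in (0 : ℝ)..1, k s := by
          gcongr
          nlinarith [ht.2]
  have := h t ht
  nlinarith

/-- Grönwall's inequality in integral form on `[0, 1]`. -/
theorem le_of_le_add_mul_integral {w k : ℝ → ℝ} {K : ℝ} (hK : 0 ≤ K)
    (hw : ContinuousOn w (Icc 0 1)) (hk : ContinuousOn k (Icc 0 1))
    (hk0 : ∀ t ∈ Icc (0 : ℝ) 1, 0 ≤ k t)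
    (h : ∀ t ∈ Icc (0 : ℝ) 1, w t ≤ k t + K * ∫ s in (0 : ℝ)..t, w s) :
    ∀ t ∈ Icc (0 : ℝ) 1, w t ≤ k t + K * (Real.exp K * ∫ s in (0 : ℝ)..1, k s) := by
  -- Both functions are extended by constants outside `[0, 1]` to become continuous on the line; the
  -- integrals in question do not change.
  have hex (f : ℝ → ℝ) (s : ℝ) (hs : s ∈ Icc (0 : ℝ) 1) :
      IccExtend zero_le_one ((Icc (0 : ℝ) 1).domRestrict f) s = f s :=
    IccExtend_of_mem _ _ hs
  have hint (f : ℝ → ℝ) (t : ℝ) (ht : t ∈ Icc (0 : ℝ) 1) :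
      ∫ s in (0 : ℝ)..t, IccExtend zero_le_one ((Icc (0 : ℝ) 1).domRestrict f) s =
        ∫ s in (0 : ℝ)..t, f s := by
    refine intervalIntegral.integral_congr fun s hs => hex f s ?_
    rw [uIcc_of_le ht.1] at hs
    exact ⟨hs.1, hs.2.trans ht.2⟩
  have := le_of_le_add_mul_integral_of_continuous hK (hw.domRestrict.Icc_extend' (h := zero_le_one))
    (hk.domRestrict.Icc_extend' (h := zero_le_one)) (fun t ht => by rw [hex k t ht]; exact hk0 t ht)
    (fun t ht => by rw [hex k t ht, hex w t ht, hint w t ht]; exact h t ht)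
  intro t ht
  have := this t ht
  rwa [hex k t ht, hex w t ht, hint k 1 (right_mem_Icc.mpr zero_le_one)] at this

theorem sq_integral_mul_le {X : Type*} [MeasurableSpace X] {ν : Measure X} {a u : X → ℝ}
    (ha : MemLp a 2 ν) (hu : MemLp u 2 ν) :
    (∫ x, a x * u x ∂ν) ^ 2 ≤ (∫ x, a x ^ 2 ∂ν) * ∫ x, u x ^ 2 ∂ν := by
  have key (f g : X → ℝ) (hf : MemLp f 2 ν) (hg : MemLp g 2 ν) :
      inner ℝ (hf.toLp f) (hg.toLp g) = ∫ x, f x * g x ∂ν := by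
    rw [L2.inner_def]
    refine integral_congr_ae ?_
    filter_upwards [hf.coeFn_toLp, hg.coeFn_toLp] with x h1 h2
    rw [h1, h2]
    simp [mul_comm]
  have := real_inner_mul_inner_self_le (ha.toLp a) (hu.toLp u)
  rw [key, key, key] at this
  simpa only [sq] using this

/-! ### Weak convergence of sequences in Hilbert spaces -/

/-- Weak convergence of a sequence. -/
def WeakTendsto {H : Type*} [NormedAddCommGroup H] [InnerProductSpace ℝ H] (x : ℕ → H) (y : H) :
    Prop :=
  ∀ ℓ : H →L[ℝ] ℝ, Tendsto (fun n => ℓ (x n)) atTop (𝓝 (ℓ y))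

section

variable {H : Type*} [NormedAddCommGroup H] [InnerProductSpace ℝ H]

theorem WeakTendsto.comp_strictMono {x : ℕ → H} {y : H} (h : WeakTendsto x y) {θ : ℕ → ℕ}
    (hθ : StrictMono θ) : WeakTendsto (x ∘ θ) y :=
  fun ℓ => (h ℓ).comp hθ.tendsto_atTop

theorem WeakTendsto.const (y : H) : WeakTendsto (fun _ => y) y :=
  fun _ => tendsto_const_nhds

/-- Coordinates in a basis are continuous functionals, and coordinatewise convergence is norm
convergence. This upgrade from weak to strong is why the state spaces of the differential equations
must be finite-dimensional. -/
theorem WeakTendsto.map_finiteDimensional {F : Type*} [NormedAddCommGroup F] [NormedSpace ℝ F]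
    [FiniteDimensional ℝ F] {x : ℕ → H} {y : H} (h : WeakTendsto x y) (ℓ : H →L[ℝ] F) :
    Tendsto (fun n => ℓ (x n)) atTop (𝓝 (ℓ y)) := by
  let b := (Module.finBasis ℝ F).equivFunL
  have : Tendsto (fun n => b (ℓ (x n))) atTop (𝓝 (b (ℓ y))) := by
    rw [tendsto_pi_nhds]
    intro i
    exact h ((ContinuousLinearMap.proj (R := ℝ) (φ := fun _ => ℝ) i).comp
      ((b : F →L[ℝ] (Fin (Module.finrank ℝ F) → ℝ)).comp ℓ))
  have h2 := (b.symm.continuous.tendsto _).comp this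
  simpa [Function.comp_def] using h2

/-- The closed span `S` of the sequence is separable, so closed balls in its dual are weak-*
sequentially compact, and Riesz representation carries this back to `S`. A functional on the whole
space acts on the sequence only through its restriction to `S`; no separability of `H` is needed. -/
theorem exists_weakTendsto_subseq [CompleteSpace H] {x : ℕ → H} {M : ℝ} (hx : ∀ n, ‖x n‖ ≤ M) :
    ∃ (y : H) (θ : ℕ → ℕ), StrictMono θ ∧ WeakTendsto (x ∘ θ) y := by
  let S : Submodule ℝ H := (Submodule.span ℝ (range x)).topologicalClosure
  have hS : TopologicalSpace.IsSeparable (S : Set H) :=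
    ((countable_range x).isSeparable.span (R := ℝ)).closure
  have : TopologicalSpace.SeparableSpace S := hS.separableSpace
  have : CompleteSpace S := (Submodule.isClosed_topologicalClosure _).completeSpace_coe
  have hxS (n : ℕ) : x n ∈ S :=
    Submodule.le_topologicalClosure _ (Submodule.subset_span (mem_range_self n))
  let k : ℕ → S := fun n => ⟨x n, hxS n⟩
  let D := InnerProductSpace.toDual ℝ S
  have hc := WeakDual.isSeqCompact_closedBall ℝ S (0 : StrongDual ℝ S) M
  obtain ⟨f, -, θ, hθ, hf⟩ := hc (x := fun n => StrongDual.toWeakDual (D (k n))) (fun n => by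
    simp only [mem_preimage, mem_closedBall_zero_iff]
    change ‖D (k n)‖ ≤ M
    rw [LinearIsometryEquiv.norm_map]
    exact hx n)
  refine ⟨(D.symm (WeakDual.toStrongDual f) : S), θ, hθ, fun ℓ => ?_⟩
  let kl : S := D.symm (ℓ.comp S.subtypeL)
  have hkl (z : S) : ℓ z = inner ℝ z kl := by
    have : inner ℝ kl z = (ℓ.comp S.subtypeL) z := InnerProductSpace.toDual_symm_apply
    rw [real_inner_comm, this]
    rfl
  have h1 := ((WeakDual.eval_continuous (𝕜 := ℝ) kl).tendsto f).comp hf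
  have h2 : ℓ (D.symm (WeakDual.toStrongDual f) : S) = f kl := by
    rw [hkl]
    exact InnerProductSpace.toDual_symm_apply
  rw [h2]
  refine h1.congr fun n => ?_
  change inner ℝ (k (θ n)) kl = ℓ (k (θ n))
  rw [hkl]

end

/-! ### Integrals along square integrable controls -/

section Control

variable {V : Type*} [NormedAddCommGroup V] [InnerProductSpace ℝ V]
  {Z : Type*} [NormedAddCommGroup Z] [NormedSpace ℝ Z]

theorem integral_norm_sq_eq {X H : Type*} [MeasurableSpace X] {ν : Measure X}
    [NormedAddCommGroup H] [InnerProductSpace ℝ H] (v : Lp H 2 ν) :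
    ∫ x, ‖v x‖ ^ 2 ∂ν = ‖v‖ ^ 2 := by
  rw [← real_inner_self_eq_norm_sq, L2.inner_def]
  simp only [real_inner_self_eq_norm_sq]

theorem memLp_two_of_continuousOn {g : ℝ → ℝ} (hg : ContinuousOn g (Icc 0 1)) :
    MemLp g 2 (volume.restrict (Icc (0 : ℝ) 1)) := by
  obtain ⟨C, hC⟩ := isCompact_Icc.exists_bound_of_continuousOn hg
  exact MemLp.of_bound (hg.aestronglyMeasurable measurableSet_Icc) C
    ((ae_restrict_mem measurableSet_Icc).mono hC)

theorem restrict_Ioc_le {a b : ℝ} (ha : 0 ≤ a) (hb : b ≤ 1) :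
    volume.restrict (Ioc a b) ≤ volume.restrict (Icc (0 : ℝ) 1) :=
  Measure.restrict_mono (Ioc_subset_Icc_self.trans (Icc_subset_Icc ha hb)) le_rfl

theorem intervalIntegrable_of_integrable_Icc {E : Type*} [NormedAddCommGroup E] {f : ℝ → E}
    (hf : Integrable f (volume.restrict (Icc (0 : ℝ) 1))) {a b : ℝ} (ha : a ∈ Icc (0 : ℝ) 1)
    (hb : b ∈ Icc (0 : ℝ) 1) : IntervalIntegrable f volume a b :=
  ⟨hf.mono_measure (restrict_Ioc_le ha.1 hb.2), hf.mono_measure (restrict_Ioc_le hb.1 ha.2)⟩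

theorem integrable_norm_mul {E : Type*} [NormedAddCommGroup E] (v : TimeL2 E) {g : ℝ → ℝ} (hg : ContinuousOn g (Icc 0 1)) :
    Integrable (fun s => ‖v s‖ * g s) (volume.restrict (Icc (0 : ℝ) 1)) :=
  (Lp.memLp v).norm.integrable_mul (memLp_two_of_continuousOn hg)

theorem sq_integral_norm_mul_le (v : TimeL2 V) {g : ℝ → ℝ} (hg : ContinuousOn g (Icc 0 1))
    {a b : ℝ} (ha : 0 ≤ a) (hab : a ≤ b) (hb : b ≤ 1) :
    (∫ s in a..b, ‖v s‖ * g s) ^ 2 ≤ ‖v‖ ^ 2 * ∫ s in a..b, g s ^ 2 := by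
  have hle := restrict_Ioc_le ha hb
  rw [intervalIntegral.integral_of_le hab, intervalIntegral.integral_of_le hab]
  refine (sq_integral_mul_le ((Lp.memLp v).norm.mono_measure hle)
    ((memLp_two_of_continuousOn hg).mono_measure hle)).trans ?_
  refine mul_le_mul_of_nonneg_right ?_ (integral_nonneg fun _ => sq_nonneg _)
  rw [← integral_norm_sq_eq]
  exact integral_mono_measure hle (Eventually.of_forall fun _ => sq_nonneg _)
    (Lp.memLp v).norm.integrable_sq

/-- The growth constant in Grönwall's inequality for a control of norm at most `M`. -/
noncomputable def growth (c M : ℝ) : ℝ :=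
  √(2 * (1 + 2 * (c * M) ^ 2 * Real.exp (2 * (c * M) ^ 2)))

theorem growth_nonneg (c M : ℝ) : 0 ≤ growth c M := Real.sqrt_nonneg _

/-- The control is only square integrable in time, so Grönwall is applied to `u²`: by `(a + b)² ≤
2a² + 2b²` and Cauchy–Schwarz the rate `‖v s‖` is replaced by the constant `2 (cM)²`. -/
theorem sq_le_of_le_add_integral_norm_mul {v : TimeL2 V} {c M : ℝ} (hv : ‖v‖ ≤ M)
    {u h : ℝ → ℝ} (hu : ContinuousOn u (Icc 0 1)) (hh : ContinuousOn h (Icc 0 1))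
    (hu0 : ∀ t ∈ Icc (0 : ℝ) 1, 0 ≤ u t)
    (huh : ∀ t ∈ Icc (0 : ℝ) 1, u t ≤ h t + c * ∫ s in (0 : ℝ)..t, ‖v s‖ * u s) :
    ∀ t ∈ Icc (0 : ℝ) 1, u t ^ 2 ≤ 2 * h t ^ 2 +
      2 * (c * M) ^ 2 * (Real.exp (2 * (c * M) ^ 2) * ∫ s in (0 : ℝ)..1, 2 * h s ^ 2) := by
  refine le_of_le_add_mul_integral (by positivity) (hu.pow 2) ((hh.pow 2).const_mul 2)
    (fun t _ => by positivity) fun t ht => ?_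
  have h1 := sq_integral_norm_mul_le v hu le_rfl ht.1 ht.2
  have h2 : 0 ≤ ∫ s in (0 : ℝ)..t, u s ^ 2 :=
    intervalIntegral.integral_nonneg ht.1 fun _ _ => sq_nonneg _
  have h3 : ‖v‖ ^ 2 ≤ M ^ 2 := by gcongr
  have h4 : u t ^ 2 ≤ (h t + c * ∫ s in (0 : ℝ)..t, ‖v s‖ * u s) ^ 2 :=
    pow_le_pow_left₀ (hu0 t ht) (huh t ht) 2
  have h5 : c ^ 2 * (∫ s in (0 : ℝ)..t, ‖v s‖ * u s) ^ 2 ≤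
      c ^ 2 * (M ^ 2 * ∫ s in (0 : ℝ)..t, u s ^ 2) := by
    gcongr
    exact h1.trans (by gcongr)
  nlinarith [sq_nonneg (h t - c * ∫ s in (0 : ℝ)..t, ‖v s‖ * u s)]

/-- For constant forcing `δ` the previous bound is exactly `(growth c M * δ)²`. -/
theorem le_growth_mul {v : TimeL2 V} {c M : ℝ} (hv : ‖v‖ ≤ M) {u : ℝ → ℝ}
    (hu : ContinuousOn u (Icc 0 1)) (hu0 : ∀ t ∈ Icc (0 : ℝ) 1, 0 ≤ u t) {δ : ℝ} (hδ : 0 ≤ δ)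
    (huh : ∀ t ∈ Icc (0 : ℝ) 1, u t ≤ δ + c * ∫ s in (0 : ℝ)..t, ‖v s‖ * u s) :
    ∀ t ∈ Icc (0 : ℝ) 1, u t ≤ growth c M * δ := by
  intro t ht
  have := sq_le_of_le_add_integral_norm_mul hv hu continuousOn_const hu0 huh t ht
  refine le_of_sq_le_sq ?_ (mul_nonneg (growth_nonneg _ _) hδ)
  rw [mul_pow, growth, Real.sq_sqrt (by positivity)]
  simp only [intervalIntegral.integral_const, sub_zero, one_smul] at this
  linarith

variable {G : ℝ → V →L[ℝ] Z}

theorem memLp_clm_apply (hG : ContinuousOn G (Icc 0 1)) (v : TimeL2 V) :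
    MemLp (fun s => G s (v s)) 2 (volume.restrict (Icc (0 : ℝ) 1)) := by
  obtain ⟨C, hC⟩ := isCompact_Icc.exists_bound_of_continuousOn hG
  refine MemLp.of_le_mul (c := C) (Lp.memLp v) ?_ ?_
  · exact isBoundedBilinearMap_apply.continuous.comp_aestronglyMeasurable
      ((hG.aestronglyMeasurable measurableSet_Icc).prodMk (Lp.aestronglyMeasurable v))
  · filter_upwards [ae_restrict_mem measurableSet_Icc] with s hs
    exact (G s).le_of_opNorm_le (hC s hs) _

theorem integrable_clm_apply (hG : ContinuousOn G (Icc 0 1)) (v : TimeL2 V) :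
    Integrable (fun s => G s (v s)) (volume.restrict (Icc (0 : ℝ) 1)) :=
  (memLp_clm_apply hG v).integrable one_le_two

theorem continuousOn_integral_clm_apply (hG : ContinuousOn G (Icc 0 1)) (v : TimeL2 V) :
    ContinuousOn (fun t => ∫ s in (0 : ℝ)..t, G s (v s)) (Icc 0 1) := by
  have := intervalIntegral.continuousOn_primitive_interval (μ := volume) (a := (0 : ℝ)) (b := 1)
    (f := fun s => G s (v s)) (by
      rw [uIcc_of_le zero_le_one]
      exact integrable_clm_apply hG v)
  rwa [uIcc_of_le zero_le_one] at this

theorem norm_integral_clm_apply_le (v : TimeL2 V) {g : ℝ → ℝ}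
    (hg : ContinuousOn g (Icc 0 1)) (hGg : ∀ s ∈ Icc (0 : ℝ) 1, ‖G s‖ ≤ g s) {a b : ℝ}
    (ha : 0 ≤ a) (hab : a ≤ b) (hb : b ≤ 1) :
    ‖∫ s in a..b, G s (v s)‖ ≤ ∫ s in a..b, ‖v s‖ * g s := by
  refine intervalIntegral.norm_integral_le_of_norm_le hab
    (Eventually.of_forall fun s hs => ?_)
    (intervalIntegrable_of_integrable_Icc (integrable_norm_mul v hg) ⟨ha, hab.trans hb⟩
      ⟨ha.trans hab, hb⟩)
  rw [mul_comm]
  exact (G s).le_of_opNorm_le (hGg s ⟨ha.trans hs.1.le, hs.2.trans hb⟩) _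

theorem norm_integral_clm_apply_le_mul (v : TimeL2 V) {C : ℝ}
    (hC : ∀ s ∈ Icc (0 : ℝ) 1, ‖G s‖ ≤ C) {t : ℝ} (ht : t ∈ Icc (0 : ℝ) 1) :
    ‖∫ s in (0 : ℝ)..t, G s (v s)‖ ≤ C * ‖v‖ := by
  have hC0 : 0 ≤ C := (norm_nonneg _).trans (hC t ht)
  refine le_of_sq_le_sq ?_ (by positivity)
  calc ‖∫ s in (0 : ℝ)..t, G s (v s)‖ ^ 2 ≤ (∫ s in (0 : ℝ)..t, ‖v s‖ * C) ^ 2 := by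
        gcongr
        exact norm_integral_clm_apply_le v continuousOn_const hC le_rfl ht.1 ht.2
    _ ≤ ‖v‖ ^ 2 * ∫ s in (0 : ℝ)..t, C ^ 2 :=
        sq_integral_norm_mul_le v continuousOn_const le_rfl ht.1 ht.2
    _ ≤ (C * ‖v‖) ^ 2 := by
        simp only [intervalIntegral.integral_const, sub_zero, smul_eq_mul]
        nlinarith [mul_nonneg (sq_nonneg ‖v‖) (sq_nonneg C), ht.2]

/-- Integration of a continuous family of operators against a control is continuous in the
control. -/
theorem exists_clm_integral (hG : ContinuousOn G (Icc 0 1)) {t : ℝ} (ht : t ∈ Icc (0 : ℝ) 1) :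
    ∃ ℓ : TimeL2 V →L[ℝ] Z, ∀ v, ℓ v = ∫ s in (0 : ℝ)..t, G s (v s) := by
  obtain ⟨C, hC⟩ := isCompact_Icc.exists_bound_of_continuousOn hG
  have h0 : (0 : ℝ) ∈ Icc (0 : ℝ) 1 := left_mem_Icc.mpr zero_le_one
  refine ⟨LinearMap.mkContinuous
    { toFun := fun v => ∫ s in (0 : ℝ)..t, G s (v s)
      map_add' := fun v w => ?_
      map_smul' := fun r v => ?_ } C fun v => norm_integral_clm_apply_le_mul v hC ht,
    fun v => rfl⟩
  · rw [← intervalIntegral.integral_add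
      (intervalIntegrable_of_integrable_Icc (integrable_clm_apply hG v) h0 ht)
      (intervalIntegrable_of_integrable_Icc (integrable_clm_apply hG w) h0 ht)]
    simp only [intervalIntegral.integral_of_le ht.1]
    refine integral_congr_ae ?_
    filter_upwards [(Measure.absolutelyContinuous_of_le
      (restrict_Ioc_le le_rfl ht.2)).ae_le (Lp.coeFn_add v w)] with s hs
    rw [hs, Pi.add_apply, map_add]
  · rw [RingHom.id_apply, ← intervalIntegral.integral_smul]
    simp only [intervalIntegral.integral_of_le ht.1]
    refine integral_congr_ae ?_
    filter_upwards [(Measure.absolutelyContinuous_of_le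
      (restrict_Ioc_le le_rfl ht.2)).ae_le (Lp.coeFn_smul r v)] with s hs
    rw [hs, Pi.smul_apply, map_smul]

end Control

/-! ### Controlled differential equations -/

section ControlledODE

variable {V : Type*} [NormedAddCommGroup V] [InnerProductSpace ℝ V]
  {Z : Type*} [NormedAddCommGroup Z] [NormedSpace ℝ Z]

/-- A time-dependent field of operators that is continuous along continuous curves and uniformly
Lipschitz in the state. -/
structure IsLipschitzField (B : ℝ → Z → V →L[ℝ] Z) (c : ℝ) : Prop where
  continuousOn : ∀ z : ℝ → Z, ContinuousOn z (Icc 0 1) →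
    ContinuousOn (fun s => B s (z s)) (Icc 0 1)
  norm_sub_le : ∀ s ∈ Icc (0 : ℝ) 1, ∀ y z, ‖B s y - B s z‖ ≤ c * ‖y - z‖

/-- `z` solves `ż = B(z) v`, `z₀ = x` on `[0, 1]`, in integral form. -/
structure IsSolution (B : ℝ → Z → V →L[ℝ] Z) (v : TimeL2 V) (x : Z) (z : ℝ → Z) : Prop where
  continuousOn : ContinuousOn z (Icc 0 1)
  eq_integral : ∀ t ∈ Icc (0 : ℝ) 1, z t = x + ∫ s in (0 : ℝ)..t, B s (z s) (v s)

variable {B B' : ℝ → Z → V →L[ℝ] Z} {c : ℝ} {v v' : TimeL2 V} {x x' : Z} {z z' : ℝ → Z}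

theorem IsLipschitzField.norm_integral_sub_le (hB : IsLipschitzField B c) (v : TimeL2 V)
    (hz : ContinuousOn z (Icc 0 1)) (hz' : ContinuousOn z' (Icc 0 1)) {t : ℝ}
    (ht : t ∈ Icc (0 : ℝ) 1) :
    ‖(∫ s in (0 : ℝ)..t, B s (z s) (v s)) - ∫ s in (0 : ℝ)..t, B s (z' s) (v s)‖ ≤
      c * ∫ s in (0 : ℝ)..t, ‖v s‖ * ‖z s - z' s‖ := by
  have h0 : (0 : ℝ) ∈ Icc (0 : ℝ) 1 := left_mem_Icc.mpr zero_le_one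
  rw [← intervalIntegral.integral_sub
    (intervalIntegrable_of_integrable_Icc (integrable_clm_apply (hB.continuousOn z hz) v) h0 ht)
    (intervalIntegrable_of_integrable_Icc (integrable_clm_apply (hB.continuousOn z' hz') v) h0 ht)]
  refine (norm_integral_clm_apply_le (G := fun s => B s (z s) - B s (z' s)) v
    (g := fun s => c * ‖z s - z' s‖) ((hz.sub hz').norm.const_mul c)
    (fun s hs => hB.norm_sub_le s hs _ _) le_rfl ht.1 ht.2).trans (le_of_eq ?_)
  rw [← intervalIntegral.integral_const_mul]
  exact intervalIntegral.integral_congr fun s _ => mul_left_comm _ _ _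

/-- Comparison of two solutions of controlled differential equations. -/
theorem IsSolution.norm_sub_le (hB : IsLipschitzField B c) (hB' : IsLipschitzField B' c)
    (h : IsSolution B v x z) (h' : IsSolution B' v' x' z') {t : ℝ} (ht : t ∈ Icc (0 : ℝ) 1) :
    ‖z' t - z t‖ ≤ (‖x' - x‖ + (∫ s in (0 : ℝ)..1, ‖v' s‖ * ‖B' s (z s) - B s (z s)‖) +
      ‖(∫ s in (0 : ℝ)..t, B s (z s) (v' s)) - ∫ s in (0 : ℝ)..t, B s (z s) (v s)‖) +
      c * ∫ s in (0 : ℝ)..t, ‖v' s‖ * ‖z' s - z s‖ := by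
  have h0 : (0 : ℝ) ∈ Icc (0 : ℝ) 1 := left_mem_Icc.mpr zero_le_one
  have hc := hB.continuousOn z h.continuousOn
  have hc' := hB'.continuousOn z h.continuousOn
  -- Change of initial value, of field, of control and of state, in this order. The second and third
  -- terms are taken along the fixed curve `z`; only the last involves `z'` and is left to Grönwall.
  have e : z' t - z t = (x' - x) +
      ((∫ s in (0 : ℝ)..t, B' s (z s) (v' s)) - ∫ s in (0 : ℝ)..t, B s (z s) (v' s)) +
      ((∫ s in (0 : ℝ)..t, B s (z s) (v' s)) - ∫ s in (0 : ℝ)..t, B s (z s) (v s)) +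
      ((∫ s in (0 : ℝ)..t, B' s (z' s) (v' s)) - ∫ s in (0 : ℝ)..t, B' s (z s) (v' s)) := by
    rw [h.eq_integral t ht, h'.eq_integral t ht]
    abel
  have h1 := hB'.norm_integral_sub_le v' h'.continuousOn h.continuousOn ht
  have h2 : ‖(∫ s in (0 : ℝ)..t, B' s (z s) (v' s)) - ∫ s in (0 : ℝ)..t, B s (z s) (v' s)‖ ≤
      ∫ s in (0 : ℝ)..1, ‖v' s‖ * ‖B' s (z s) - B s (z s)‖ := by
    rw [← intervalIntegral.integral_sub
      (intervalIntegrable_of_integrable_Icc (integrable_clm_apply hc' v') h0 ht)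
      (intervalIntegrable_of_integrable_Icc (integrable_clm_apply hc v') h0 ht)]
    refine (norm_integral_clm_apply_le (G := fun s => B' s (z s) - B s (z s)) v'
      (hc'.sub hc).norm (fun _ _ => le_rfl) le_rfl ht.1 ht.2).trans ?_
    exact intervalIntegral.integral_mono_interval le_rfl ht.1 ht.2
      (Eventually.of_forall fun s => by positivity)
      (intervalIntegrable_of_integrable_Icc (integrable_norm_mul v' (hc'.sub hc).norm) h0
        (right_mem_Icc.mpr zero_le_one))
  rw [e]
  refine (norm_add₄_le).trans ?_
  linarith

theorem IsSolution.norm_sub_le_growth (hB : IsLipschitzField B c) (h : IsSolution B v x z)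
    (h' : IsSolution B v x' z') {M : ℝ} (hM : ‖v‖ ≤ M) {t : ℝ} (ht : t ∈ Icc (0 : ℝ) 1) :
    ‖z' t - z t‖ ≤ growth c M * ‖x' - x‖ := by
  refine le_growth_mul hM (h'.continuousOn.sub h.continuousOn).norm (fun _ _ => norm_nonneg _)
    (norm_nonneg _) (fun t ht => ?_) t ht
  simpa using h.norm_sub_le hB hB h' ht

theorem IsSolution.unique (hB : IsLipschitzField B c) (h : IsSolution B v x z)
    (h' : IsSolution B v x z') {t : ℝ} (ht : t ∈ Icc (0 : ℝ) 1) : z' t = z t := by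
  have := h.norm_sub_le_growth hB h' le_rfl ht
  rw [sub_self, norm_zero, mul_zero, norm_le_zero_iff] at this
  exact sub_eq_zero.mp this

open Nat in
-- Picard iteration. By Cauchy–Schwarz the squared distance of the `k`-th iterates gains the factor
-- `(c‖v‖)^(2k) t^k / k!`, so some iterate of the integral operator is a contraction even if the
-- operator itself is not.
theorem exists_isSolution [CompleteSpace Z] (hB : IsLipschitzField B c) (v : TimeL2 V) (x : Z) :
    ∃ z, IsSolution B v x z := by
  let ext (y : C(Icc (0 : ℝ) 1, Z)) : ℝ → Z := IccExtend zero_le_one y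
  have hext (y : C(Icc (0 : ℝ) 1, Z)) : ContinuousOn (ext y) (Icc 0 1) :=
    (y.continuous.Icc_extend' (h := zero_le_one)).continuousOn
  let T (y : C(Icc (0 : ℝ) 1, Z)) : C(Icc (0 : ℝ) 1, Z) :=
    ⟨fun t => x + ∫ s in (0 : ℝ)..t, B s (ext y s) (v s), continuous_const.add
      (continuousOn_integral_clm_apply (hB.continuousOn _ (hext y)) v).domRestrict⟩
  have hiter (y w : C(Icc (0 : ℝ) 1, Z)) (k : ℕ) (t : ℝ) (ht : t ∈ Icc (0 : ℝ) 1) :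
      ‖ext (T^[k] y) t - ext (T^[k] w) t‖ ^ 2 ≤
        ((c * ‖v‖) ^ 2) ^ k * (t ^ k / k !) * dist y w ^ 2 := by
    induction k generalizing t with
    | zero =>
      simp only [Function.iterate_zero, id_eq, pow_zero, Nat.factorial_zero, Nat.cast_one, div_one,
        one_mul, ext, IccExtend_of_mem _ _ ht, ← dist_eq_norm]
      gcongr
      exact ContinuousMap.dist_apply_le_dist _
    | succ k ih =>
      rw [Function.iterate_succ_apply', Function.iterate_succ_apply']
      have e (y : C(Icc (0 : ℝ) 1, Z)) :
          ext (T y) t = x + ∫ s in (0 : ℝ)..t, B s (ext y s) (v s) := IccExtend_of_mem _ _ ht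
      have hd := ((hext (T^[k] y)).sub (hext (T^[k] w))).norm
      rw [e, e, add_sub_add_left_eq_sub]
      calc _ ≤ (c * ∫ s in (0 : ℝ)..t, ‖v s‖ * ‖ext (T^[k] y) s - ext (T^[k] w) s‖) ^ 2 := by
            gcongr
            exact hB.norm_integral_sub_le v (hext _) (hext _) ht
        _ ≤ c ^ 2 * (‖v‖ ^ 2 * ∫ s in (0 : ℝ)..t, ‖ext (T^[k] y) s - ext (T^[k] w) s‖ ^ 2) := by
            rw [mul_pow]
            gcongr
            exact sq_integral_norm_mul_le v hd le_rfl ht.1 ht.2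
        _ ≤ c ^ 2 * (‖v‖ ^ 2 * ∫ s in (0 : ℝ)..t,
              ((c * ‖v‖) ^ 2) ^ k * (s ^ k / k !) * dist y w ^ 2) := by
            gcongr
            refine intervalIntegral.integral_mono_on ht.1 ?_ ?_ fun s hs =>
              ih s ⟨hs.1, hs.2.trans ht.2⟩
            · refine ContinuousOn.intervalIntegrable ?_
              rw [uIcc_of_le ht.1]
              exact (hd.pow 2).mono (Icc_subset_Icc_right ht.2)
            · exact Continuous.intervalIntegrable (by fun_prop) _ _
        _ = _ := by
            rw [intervalIntegral.integral_mul_const, intervalIntegral.integral_const_mul,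
              intervalIntegral.integral_div, integral_pow, Nat.factorial_succ]
            push_cast
            field_simp
            ring
  -- The threshold is `(1/2)²` because `hiter` bounds squared distances.
  obtain ⟨k, hk⟩ := ((FloorSemiring.tendsto_pow_div_factorial_atTop ((c * ‖v‖) ^ 2)).eventually
    (gt_mem_nhds (by norm_num : (0 : ℝ) < (1 / 2) ^ 2))).exists
  have hcontr : ContractingWith (1 / 2) T^[k] := by
    refine ⟨by norm_num, LipschitzWith.of_dist_le_mul fun y w => ?_⟩
    rw [ContinuousMap.dist_le (by positivity)]
    intro t
    have := hiter y w k t t.2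
    simp only [ext, IccExtend_of_mem _ _ t.2, Subtype.coe_eta] at this
    rw [dist_eq_norm]
    refine le_of_sq_le_sq ?_ (by positivity)
    rw [mul_pow]
    refine this.trans (mul_le_mul_of_nonneg_right ?_ (sq_nonneg _))
    calc ((c * ‖v‖) ^ 2) ^ k * ((t : ℝ) ^ k / k !) ≤ ((c * ‖v‖) ^ 2) ^ k * (1 / k !) := by
          gcongr
          exact pow_le_one₀ t.2.1 t.2.2
      _ ≤ (1 / 2) ^ 2 := by
          rw [mul_one_div]
          exact hk.le
      _ = _ := by norm_num
  -- The unique fixed point of `T^[k]` is fixed by `T` too, since `T` commutes with its iterates.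
  have hfix := hcontr.isFixedPt_fixedPoint_iterate
  set y := ContractingWith.fixedPoint T^[k] hcontr
  refine ⟨ext y, hext y, fun t ht => ?_⟩
  calc ext y t = y ⟨t, ht⟩ := IccExtend_of_mem _ _ ht
    _ = T y ⟨t, ht⟩ := by rw [hfix]
    _ = _ := rfl

/-- Solutions depend continuously on the initial value, the field and, for the weak topology, the
control. -/
theorem IsSolution.tendsto [FiniteDimensional ℝ Z] {B' : ℕ → ℝ → Z → V →L[ℝ] Z}
    {v' : ℕ → TimeL2 V} {x' : ℕ → Z} {z' : ℕ → ℝ → Z} {M D : ℝ}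
    (hB : IsLipschitzField B c) (hB' : ∀ n, IsLipschitzField (B' n) c)
    (h : IsSolution B v x z) (h' : ∀ n, IsSolution (B' n) (v' n) (x' n) (z' n))
    (hM : ∀ n, ‖v' n‖ ≤ M) (hx : Tendsto x' atTop (𝓝 x)) (hv : WeakTendsto v' v)
    (hD : ∀ n, ∀ s ∈ Icc (0 : ℝ) 1, ‖B' n s (z s) - B s (z s)‖ ≤ D)
    (hBz : ∀ s ∈ Icc (0 : ℝ) 1, Tendsto (fun n => ‖B' n s (z s) - B s (z s)‖) atTop (𝓝 0))
    {t : ℝ} (ht : t ∈ Icc (0 : ℝ) 1) : Tendsto (fun n => z' n t) atTop (𝓝 (z t)) := by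
  have hc := hB.continuousOn z h.continuousOn
  have hb (n : ℕ) : ContinuousOn (fun s => ‖B' n s (z s) - B s (z s)‖) (Icc 0 1) :=
    (((hB' n).continuousOn z h.continuousOn).sub hc).norm
  obtain ⟨C, hC⟩ := isCompact_Icc.exists_bound_of_continuousOn hc
  let I (n : ℕ) : ℝ := ∫ s in (0 : ℝ)..1, ‖v' n s‖ * ‖B' n s (z s) - B s (z s)‖
  let g (n : ℕ) (t : ℝ) : ℝ :=
    ‖(∫ s in (0 : ℝ)..t, B s (z s) (v' n s)) - ∫ s in (0 : ℝ)..t, B s (z s) (v s)‖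
  let k (n : ℕ) (t : ℝ) : ℝ := ‖x' n - x‖ + I n + g n t
  have haesm {f : ℝ → ℝ} (hf : ContinuousOn f (Icc 0 1)) :
      AEStronglyMeasurable f (volume.restrict (uIoc (0 : ℝ) 1)) := by
    rw [uIoc_of_le zero_le_one]
    exact (hf.mono Ioc_subset_Icc_self).aestronglyMeasurable measurableSet_Ioc
  have hmem {s : ℝ} (hs : s ∈ uIoc (0 : ℝ) 1) : s ∈ Icc (0 : ℝ) 1 := by
    rw [uIoc_of_le zero_le_one] at hs
    exact Ioc_subset_Icc_self hs
  -- Cauchy–Schwarz with `‖v' n‖ ≤ M` reduces this to dominated convergence for the squared field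
  -- differences.
  have hI : Tendsto I atTop (𝓝 0) := by
    have h1 : Tendsto (fun n => ∫ s in (0 : ℝ)..1, ‖B' n s (z s) - B s (z s)‖ ^ 2) atTop
        (𝓝 (∫ _ in (0 : ℝ)..1, (0 : ℝ))) := by
      refine intervalIntegral.tendsto_integral_filter_of_dominated_convergence (fun _ => D ^ 2)
        (Eventually.of_forall fun n => haesm ((hb n).pow 2))
        (Eventually.of_forall fun n => Eventually.of_forall fun s hs => ?_)
        intervalIntegrable_const (Eventually.of_forall fun s hs => ?_)
      · rw [Real.norm_of_nonneg (sq_nonneg _)]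
        gcongr
        exact hD n s (hmem hs)
      · simpa using (hBz s (hmem hs)).pow 2
    have h2 : Tendsto (fun n => I n ^ 2) atTop (𝓝 0) := by
      refine squeeze_zero (fun _ => sq_nonneg _) (fun n =>
        (sq_integral_norm_mul_le (v' n) (hb n) le_rfl zero_le_one le_rfl).trans ?_)
        (by simpa using h1.const_mul (M ^ 2))
      gcongr
      · exact intervalIntegral.integral_nonneg zero_le_one fun _ _ => sq_nonneg _
      · exact hM n
    have h3 := h2.sqrt
    rw [Real.sqrt_zero] at h3
    exact squeeze_zero_norm (fun n => le_of_eq (by rw [Real.sqrt_sq_eq_abs, Real.norm_eq_abs])) h3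
  -- The only use of weak convergence: along the fixed curve `z` the integral is continuous and
  -- linear in the control, with values in a finite-dimensional space.
  have hgt (t : ℝ) (ht : t ∈ Icc (0 : ℝ) 1) : Tendsto (fun n => g n t) atTop (𝓝 0) := by
    obtain ⟨ℓ, hℓ⟩ := exists_clm_integral hc ht
    have := (hv.map_finiteDimensional ℓ).sub_const (ℓ v)
    rw [sub_self] at this
    simpa only [hℓ, norm_zero] using this.norm
  have hkt (t : ℝ) (ht : t ∈ Icc (0 : ℝ) 1) : Tendsto (fun n => k n t) atTop (𝓝 0) := by
    have h1 : Tendsto (fun n => ‖x' n - x‖) atTop (𝓝 0) := tendsto_iff_norm_sub_tendsto_zero.mp hx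
    simpa using (h1.add hI).add (hgt t ht)
  have hk (n : ℕ) : ContinuousOn (k n) (Icc 0 1) :=
    continuousOn_const.add ((continuousOn_integral_clm_apply hc (v' n)).sub
      (continuousOn_integral_clm_apply hc v)).norm
  have hk0 (n : ℕ) (t : ℝ) : 0 ≤ k n t :=
    add_nonneg (add_nonneg (norm_nonneg _) (intervalIntegral.integral_nonneg zero_le_one
      fun _ _ => by positivity)) (norm_nonneg _)
  obtain ⟨D', hD'⟩ : ∃ D', ∀ n, ∀ t ∈ Icc (0 : ℝ) 1, k n t ≤ D' := by
    have h1 : Tendsto (fun n => ‖x' n - x‖ + I n) atTop (𝓝 (0 + 0)) :=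
      (tendsto_iff_norm_sub_tendsto_zero.mp hx).add hI
    obtain ⟨b, hb⟩ := h1.bddAbove_range
    refine ⟨b + (C * M + C * ‖v‖), fun n t ht => ?_⟩
    refine add_le_add (hb (mem_range_self n)) ((_root_.norm_sub_le _ _).trans (add_le_add ?_ ?_))
    · refine (norm_integral_clm_apply_le_mul (v' n) hC ht).trans ?_
      exact mul_le_mul_of_nonneg_left (hM n) ((norm_nonneg _).trans (hC t ht))
    · exact norm_integral_clm_apply_le_mul v hC ht
  have hint : Tendsto (fun n => ∫ s in (0 : ℝ)..1, 2 * k n s ^ 2) atTop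
      (𝓝 (∫ _ in (0 : ℝ)..1, (0 : ℝ))) := by
    refine intervalIntegral.tendsto_integral_filter_of_dominated_convergence (fun _ => 2 * D' ^ 2)
      (Eventually.of_forall fun n => haesm (((hk n).pow 2).const_mul 2))
      (Eventually.of_forall fun n => Eventually.of_forall fun s hs => ?_)
      intervalIntegrable_const (Eventually.of_forall fun s hs => ?_)
    · rw [Real.norm_of_nonneg (by positivity)]
      gcongr
      · exact hk0 n s
      · exact hD' n s (hmem hs)
    · simpa using ((hkt s (hmem hs)).pow 2).const_mul 2
  -- The bound involves `k n` only at the time `t` and through `∫ (k n)²`. Pointwise convergence in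
  -- time, with the uniform bound `D'`, therefore suffices.
  have hfin (n : ℕ) := sq_le_of_le_add_integral_norm_mul (hM n)
    ((h' n).continuousOn.sub h.continuousOn).norm (hk n) (fun _ _ => norm_nonneg _)
    (fun t ht => h.norm_sub_le hB (hB' n) (h' n) ht) t ht
  have hsq : Tendsto (fun n => ‖z' n t - z t‖ ^ 2) atTop (𝓝 0) := by
    refine squeeze_zero (fun _ => sq_nonneg _) hfin ?_
    simpa using (((hkt t ht).pow 2).const_mul 2).add
      ((hint.const_mul (Real.exp (2 * (c * M) ^ 2))).const_mul (2 * (c * M) ^ 2))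
  rw [tendsto_iff_norm_sub_tendsto_zero]
  simpa using hsq.sqrt

end ControlledODE

/-! ### Flows of controlled vector fields -/

section Flow

/-- Quantitative form of the embedding of `V` in the `C²` vector fields. -/
structure FieldBounds (n : ℕ) (V : Type*) [NormedAddCommGroup V] [InnerProductSpace ℝ V]
    [RKHS ℝ V (Euc n) (Euc n)] (c : ℝ) : Prop where
  nonneg : 0 ≤ c
  differentiable : ∀ u : V, Differentiable ℝ ⇑u
  norm_fderiv_le : ∀ (u : V) (x : Euc n), ‖fderiv ℝ ⇑u x‖ ≤ c * ‖u‖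
  norm_fderiv_sub_le : ∀ (u : V) (x y : Euc n),
    ‖fderiv ℝ ⇑u x - fderiv ℝ ⇑u y‖ ≤ c * ‖u‖ * ‖x - y‖

variable {n : ℕ} {V : Type*} [NormedAddCommGroup V] [InnerProductSpace ℝ V]
  [RKHS ℝ V (Euc n) (Euc n)]

theorem EmbedsInC02.exists_fieldBounds (hV : EmbedsInC02 n V) : ∃ c, FieldBounds n V c := by
  obtain ⟨c, hc⟩ := hV
  have hle (u : V) : c * ‖u‖ ≤ max c 0 * ‖u‖ := by
    gcongr
    exact le_max_left _ _
  refine ⟨max c 0, le_max_right _ _, fun u => (hc u).1.differentiable two_ne_zero,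
    fun u x => ?_, fun u x y => ?_⟩
  · rw [← norm_iteratedFDeriv_one]
    exact (((hc u).2 1 one_le_two).2 x).trans (hle u)
  · refine Convex.norm_image_sub_le_of_norm_fderiv_le (𝕜 := ℝ) (s := univ) (fun z _ => ?_)
      (fun z _ => ?_) convex_univ (mem_univ y) (mem_univ x)
    · exact ((hc u).1.fderiv_right (m := 1) le_rfl).differentiable one_ne_zero z
    · rw [← norm_iteratedFDeriv_one, norm_iteratedFDeriv_fderiv]
      exact (((hc u).2 2 le_rfl).2 z).trans (hle u)

/-- Evaluation of vector fields at a point. -/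
noncomputable def evalField (V : Type*) [NormedAddCommGroup V] [InnerProductSpace ℝ V]
    [RKHS ℝ V (Euc n) (Euc n)] (x : Euc n) : V →L[ℝ] Euc n :=
  (ContinuousLinearMap.proj x).comp (RKHS.coeCLM ℝ)

variable {c : ℝ}

/-- The differential of vector fields at a point. -/
noncomputable def derivField (h : FieldBounds n V c) (x : Euc n) :
    V →L[ℝ] (Euc n →L[ℝ] Euc n) :=
  LinearMap.mkContinuous
    { toFun := fun u => fderiv ℝ ⇑u x
      map_add' := fun u w => by
        rw [RKHS.coe_add, fderiv_add (h.differentiable u x) (h.differentiable w x)]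
      map_smul' := fun r u => by
        rw [RKHS.coe_smul, fderiv_const_smul (h.differentiable u x), RingHom.id_apply] }
    c fun u => h.norm_fderiv_le u x

theorem norm_derivField_le (h : FieldBounds n V c) (x : Euc n) : ‖derivField h x‖ ≤ c :=
  ContinuousLinearMap.opNorm_le_bound _ h.nonneg fun u => h.norm_fderiv_le u x

theorem norm_derivField_sub_le (h : FieldBounds n V c) (x y : Euc n) :
    ‖derivField h x - derivField h y‖ ≤ c * ‖x - y‖ :=
  ContinuousLinearMap.opNorm_le_bound _ (mul_nonneg h.nonneg (norm_nonneg _)) fun u => by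
    rw [mul_right_comm]
    exact h.norm_fderiv_sub_le u x y

theorem norm_evalField_sub_le (h : FieldBounds n V c) (x y : Euc n) :
    ‖evalField V x - evalField V y‖ ≤ c * ‖x - y‖ :=
  ContinuousLinearMap.opNorm_le_bound _ (mul_nonneg h.nonneg (norm_nonneg _)) fun u => by
    rw [mul_right_comm]
    exact Convex.norm_image_sub_le_of_norm_fderiv_le (𝕜 := ℝ) (s := univ)
      (fun z _ => h.differentiable u z) (fun z _ => h.norm_fderiv_le u z) convex_univ
      (mem_univ y) (mem_univ x)

/-- The differential of vector fields at a point, in a given direction. -/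
noncomputable def derivFieldAlong (h : FieldBounds n V c) (x w : Euc n) : V →L[ℝ] Euc n :=
  (ContinuousLinearMap.apply ℝ (Euc n) w).comp (derivField h x)

theorem derivFieldAlong_apply (h : FieldBounds n V c) (x w : Euc n) (u : V) :
    derivFieldAlong h x w u = derivField h x u w := rfl

theorem norm_derivFieldAlong_le (h : FieldBounds n V c) (x w : Euc n) :
    ‖derivFieldAlong h x w‖ ≤ c * ‖w‖ :=
  ContinuousLinearMap.opNorm_le_bound _ (mul_nonneg h.nonneg (norm_nonneg _)) fun u => by
    rw [mul_right_comm]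
    exact (derivField h x u).le_of_opNorm_le (h.norm_fderiv_le u x) w

/-- Mean value inequality for `u` minus its differential at `x`, on the ball of radius `‖y - x‖`,
where the differential of `u` varies by at most `c‖u‖‖y - x‖`. Uniformity in `u` makes it an
operator-norm estimate, usable for time-dependent fields. -/
theorem norm_evalField_sub_sub_le (h : FieldBounds n V c) (x y : Euc n) :
    ‖evalField V y - evalField V x - derivFieldAlong h x (y - x)‖ ≤ c * ‖y - x‖ ^ 2 :=
  ContinuousLinearMap.opNorm_le_bound _ (mul_nonneg h.nonneg (by positivity)) fun u => by
    refine (Convex.norm_image_sub_le_of_norm_fderiv_le' (𝕜 := ℝ) (f := ⇑u)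
      (φ := fderiv ℝ ⇑u x) (C := c * ‖u‖ * ‖y - x‖) (s := Metric.closedBall x ‖y - x‖)
      (fun z _ => h.differentiable u z) (fun z hz => ?_) (convex_closedBall _ _)
      (Metric.mem_closedBall_self (norm_nonneg _)) (y := y) ?_).trans (le_of_eq (by ring))
    · refine (h.norm_fderiv_sub_le u z x).trans
        (mul_le_mul_of_nonneg_left ?_ (mul_nonneg h.nonneg (norm_nonneg _)))
      rwa [mem_closedBall_iff_norm] at hz
    · rw [mem_closedBall_iff_norm]

theorem continuous_derivField (h : FieldBounds n V c) : Continuous (derivField h) :=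
  (LipschitzWith.of_dist_le' fun x y => by
    rw [dist_eq_norm (derivField h x) (derivField h y), dist_eq_norm x y]
    exact norm_derivField_sub_le h x y).continuous

theorem continuous_evalField (h : FieldBounds n V c) : Continuous (evalField V) :=
  (LipschitzWith.of_dist_le' fun x y => by
    rw [dist_eq_norm (evalField V x) (evalField V y), dist_eq_norm x y]
    exact norm_evalField_sub_le h x y).continuous

theorem isLipschitzField_evalField (h : FieldBounds n V c) :
    IsLipschitzField (fun _ => evalField V) c :=
  ⟨fun _ hz => (continuous_evalField h).comp_continuousOn hz,
    fun _ _ => norm_evalField_sub_le h⟩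

theorem isFlow_iff {v : TimeL2 V} {φ : ℝ → Euc n → Euc n} :
    IsFlow v φ ↔ ∀ x, IsSolution (fun _ => evalField V) v x fun t => φ t x :=
  forall_congr' fun _ => ⟨fun h => ⟨h.1, h.2⟩, fun h => ⟨h.1, h.2⟩⟩

theorem isFlow_flow (h : FieldBounds n V c) (v : TimeL2 V) : IsFlow v (flow v) := by
  have hex : ∃ φ, IsFlow v φ := by
    choose z hz using exists_isSolution (isLipschitzField_evalField h) v
    exact ⟨fun t x => z x t, isFlow_iff.mpr hz⟩
  rw [flow, dif_pos hex]
  exact hex.choose_spec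

theorem isSolution_flow (h : FieldBounds n V c) (v : TimeL2 V) (x : Euc n) :
    IsSolution (fun _ => evalField V) v x fun t => flow v t x :=
  isFlow_iff.mp (isFlow_flow h v) x

theorem IsFlow.eq_flow (h : FieldBounds n V c) {v : TimeL2 V} {ψ : ℝ → Euc n → Euc n}
    (hψ : IsFlow v ψ) {t : ℝ} (ht : t ∈ Icc (0 : ℝ) 1) : ψ t = flow v t :=
  funext fun x => (isSolution_flow h v x).unique (isLipschitzField_evalField h)
    (isFlow_iff.mp hψ x) ht

/-! ### The differential of the flow -/

/-- The field of the linearized equation along the curve `y`. -/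
noncomputable def linearizedField (h : FieldBounds n V c) (y : ℝ → Euc n) (s : ℝ)
    (Y : Euc n →L[ℝ] Euc n) : V →L[ℝ] (Euc n →L[ℝ] Euc n) :=
  ((ContinuousLinearMap.compL ℝ (Euc n) (Euc n) (Euc n)).flip Y).comp (derivField h (y s))

theorem linearizedField_apply (h : FieldBounds n V c) (y : ℝ → Euc n) (s : ℝ)
    (Y : Euc n →L[ℝ] Euc n) (u : V) :
    linearizedField h y s Y u = (derivField h (y s) u).comp Y := rfl

theorem isLipschitzField_linearizedField (h : FieldBounds n V c) {y : ℝ → Euc n}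
    (hy : ContinuousOn y (Icc 0 1)) : IsLipschitzField (linearizedField h y) c := by
  refine ⟨fun Y hY => ?_, fun s _ Y Y' => ?_⟩
  · exact ((ContinuousLinearMap.compL ℝ (Euc n) (Euc n) (Euc n)).flip.continuous.comp_continuousOn
      hY).clm_comp ((continuous_derivField h).comp_continuousOn hy)
  · refine ContinuousLinearMap.opNorm_le_bound _ (mul_nonneg h.nonneg (norm_nonneg _)) fun u => ?_
    rw [sub_apply, linearizedField_apply, linearizedField_apply,
      ← ContinuousLinearMap.comp_sub]
    refine (ContinuousLinearMap.opNorm_comp_le _ _).trans ?_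
    rw [mul_right_comm]
    gcongr
    exact h.norm_fderiv_le u _

theorem norm_linearizedField_sub_le (h : FieldBounds n V c) (y y' : ℝ → Euc n) (s : ℝ)
    (Y : Euc n →L[ℝ] Euc n) :
    ‖linearizedField h y s Y - linearizedField h y' s Y‖ ≤
      ‖derivField h (y s) - derivField h (y' s)‖ * ‖Y‖ := by
  refine ContinuousLinearMap.opNorm_le_bound _ (by positivity) fun u => ?_
  rw [sub_apply, linearizedField_apply, linearizedField_apply,
    ← ContinuousLinearMap.sub_comp]
  refine (ContinuousLinearMap.opNorm_comp_le _ _).trans ?_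
  rw [mul_right_comm]
  gcongr
  exact (derivField h (y s) - derivField h (y' s)).le_opNorm u

theorem exists_linearizedFlow (h : FieldBounds n V c) (v : TimeL2 V) (x : Euc n) :
    ∃ Y, IsSolution (linearizedField h fun t => flow v t x) v (ContinuousLinearMap.id ℝ (Euc n))
      Y :=
  exists_isSolution (isLipschitzField_linearizedField h (isSolution_flow h v x).continuousOn) v _

/-- The solution of the equation linearized along the trajectory of `x`. -/
noncomputable def linearizedFlow (h : FieldBounds n V c) (v : TimeL2 V) (x : Euc n) :
    ℝ → Euc n →L[ℝ] Euc n :=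
  (exists_linearizedFlow h v x).choose

theorem isSolution_linearizedFlow (h : FieldBounds n V c) (v : TimeL2 V) (x : Euc n) :
    IsSolution (linearizedField h fun t => flow v t x) v (ContinuousLinearMap.id ℝ (Euc n))
      (linearizedFlow h v x) :=
  (exists_linearizedFlow h v x).choose_spec

theorem continuousOn_derivFieldAlong (h : FieldBounds n V c) {y w : ℝ → Euc n}
    (hy : ContinuousOn y (Icc 0 1)) (hw : ContinuousOn w (Icc 0 1)) :
    ContinuousOn (fun s => derivFieldAlong h (y s) (w s)) (Icc 0 1) :=
  ((ContinuousLinearMap.apply ℝ (Euc n)).continuous.comp_continuousOn hw).clm_comp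
    ((continuous_derivField h).comp_continuousOn hy)

theorem linearizedFlow_apply (h : FieldBounds n V c) (v : TimeL2 V) (x k : Euc n) {t : ℝ}
    (ht : t ∈ Icc (0 : ℝ) 1) :
    linearizedFlow h v x t k = k +
      ∫ s in (0 : ℝ)..t, derivFieldAlong h (flow v s x) (linearizedFlow h v x s k) (v s) := by
  have hY := isSolution_linearizedFlow h v x
  have hint := intervalIntegrable_of_integrable_Icc (integrable_clm_apply
    ((isLipschitzField_linearizedField h (isSolution_flow h v x).continuousOn).continuousOn _
      hY.continuousOn) v) (left_mem_Icc.mpr zero_le_one) ht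
  conv_lhs => rw [hY.eq_integral t ht]
  rw [add_apply, ContinuousLinearMap.intervalIntegral_apply hint]
  rfl

/-- The linear equation also has the zero solution; comparison with it bounds the solution by the
norm of its initial value, the identity. -/
theorem norm_linearizedFlow_le (h : FieldBounds n V c) {v : TimeL2 V} {M : ℝ} (hM : ‖v‖ ≤ M)
    (x : Euc n) {t : ℝ} (ht : t ∈ Icc (0 : ℝ) 1) : ‖linearizedFlow h v x t‖ ≤ growth c M := by
  have h0 : IsSolution (linearizedField h fun t => flow v t x) v 0 fun _ => 0 :=
    ⟨continuousOn_const, fun t _ => by simp [linearizedField_apply]⟩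
  have := h0.norm_sub_le_growth
    (isLipschitzField_linearizedField h (isSolution_flow h v x).continuousOn)
    (isSolution_linearizedFlow h v x) hM ht
  rw [sub_zero, sub_zero] at this
  exact this.trans (mul_le_of_le_one_right (growth_nonneg _ _) ContinuousLinearMap.norm_id_le)

/-- The remainder `R` solves the linearized equation with an extra source `G₁`, the Taylor remainder
of the field between the two trajectories. Since these stay within `growth c ‖v‖ * ‖x' - x‖` of each
other, the source is quadratic in `‖x' - x‖`, and Grönwall transfers this to `R`. -/
theorem norm_flow_sub_sub_le (h : FieldBounds n V c) (v : TimeL2 V) (x x' : Euc n) {t : ℝ}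
    (ht : t ∈ Icc (0 : ℝ) 1) :
    ‖flow v t x' - flow v t x - linearizedFlow h v x t (x' - x)‖ ≤
      growth c ‖v‖ * (c * (growth c ‖v‖ * ‖x' - x‖) ^ 2 * ‖v‖) := by
  have hy := isSolution_flow h v x
  have hy' := isSolution_flow h v x'
  have hYk : ContinuousOn (fun s => linearizedFlow h v x s (x' - x)) (Icc 0 1) :=
    (isSolution_linearizedFlow h v x).continuousOn.clm_apply continuousOn_const
  have hR := (hy'.continuousOn.sub hy.continuousOn).sub hYk
  let G₁ (s : ℝ) : V →L[ℝ] Euc n := evalField V (flow v s x') - evalField V (flow v s x) -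
    derivFieldAlong h (flow v s x) (flow v s x' - flow v s x)
  let G₂ (s : ℝ) : V →L[ℝ] Euc n := derivFieldAlong h (flow v s x)
    (flow v s x' - flow v s x - linearizedFlow h v x s (x' - x))
  have he := continuous_evalField (V := V) h
  have hc₁ : ContinuousOn G₁ (Icc 0 1) :=
    ((he.comp_continuousOn hy'.continuousOn).sub (he.comp_continuousOn hy.continuousOn)).sub
      (continuousOn_derivFieldAlong h hy.continuousOn (hy'.continuousOn.sub hy.continuousOn))
  have hc₂ : ContinuousOn G₂ (Icc 0 1) := continuousOn_derivFieldAlong h hy.continuousOn hR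
  have h0 : (0 : ℝ) ∈ Icc (0 : ℝ) 1 := left_mem_Icc.mpr zero_le_one
  refine le_growth_mul (v := v) (c := c) le_rfl hR.norm (fun _ _ => norm_nonneg _)
    (mul_nonneg (mul_nonneg h.nonneg (sq_nonneg _)) (norm_nonneg _)) (fun t ht => ?_) t ht
  have e : flow v t x' - flow v t x - linearizedFlow h v x t (x' - x) =
      (∫ s in (0 : ℝ)..t, G₁ s (v s)) + ∫ s in (0 : ℝ)..t, G₂ s (v s) := by
    have i₁ : IntervalIntegrable (fun s => evalField V (flow v s x) (v s)) volume 0 t :=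
      intervalIntegrable_of_integrable_Icc
      (integrable_clm_apply (he.comp_continuousOn hy.continuousOn) v) h0 ht
    have i₂ : IntervalIntegrable (fun s => evalField V (flow v s x') (v s)) volume 0 t :=
      intervalIntegrable_of_integrable_Icc
      (integrable_clm_apply (he.comp_continuousOn hy'.continuousOn) v) h0 ht
    have i₃ := intervalIntegrable_of_integrable_Icc
      (integrable_clm_apply (continuousOn_derivFieldAlong h hy.continuousOn hYk) v) h0 ht
    have i₄ := intervalIntegrable_of_integrable_Icc (integrable_clm_apply hc₁ v) h0 ht
    have i₅ := intervalIntegrable_of_integrable_Icc (integrable_clm_apply hc₂ v) h0 ht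
    have e₁ := hy.eq_integral t ht
    have e₂ := hy'.eq_integral t ht
    rw [e₁, e₂, linearizedFlow_apply h v x _ ht, ← intervalIntegral.integral_add i₄ i₅]
    have e₃ : ∀ s, G₁ s (v s) + G₂ s (v s) = evalField V (flow v s x') (v s) -
        evalField V (flow v s x) (v s) -
        derivFieldAlong h (flow v s x) (linearizedFlow h v x s (x' - x)) (v s) := fun s => by
      simp only [G₁, G₂, sub_apply, derivFieldAlong_apply, map_sub]
      abel
    simp only [e₃]
    rw [intervalIntegral.integral_sub (i₂.sub i₁) i₃, intervalIntegral.integral_sub i₂ i₁]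
    abel
  change ‖flow v t x' - flow v t x - linearizedFlow h v x t (x' - x)‖ ≤ _
  rw [e]
  refine (norm_add_le _ _).trans (add_le_add ?_ ?_)
  · refine norm_integral_clm_apply_le_mul v (fun s hs => ?_) ht
    refine (norm_evalField_sub_sub_le h _ _).trans (mul_le_mul_of_nonneg_left ?_ h.nonneg)
    exact pow_le_pow_left₀ (norm_nonneg _)
      (hy.norm_sub_le_growth (isLipschitzField_evalField h) hy' le_rfl hs) 2
  · refine (norm_integral_clm_apply_le v (hR.norm.const_mul c)
      (fun s _ => norm_derivFieldAlong_le h _ _) le_rfl ht.1 ht.2).trans (le_of_eq ?_)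
    rw [← intervalIntegral.integral_const_mul]
    exact intervalIntegral.integral_congr fun s _ => mul_left_comm _ _ _

theorem hasFDerivAt_flow (h : FieldBounds n V c) (v : TimeL2 V) (x : Euc n) {t : ℝ}
    (ht : t ∈ Icc (0 : ℝ) 1) : HasFDerivAt (flow v t) (linearizedFlow h v x t) x := by
  rw [hasFDerivAt_iff_isLittleO]
  refine Asymptotics.IsBigO.trans_isLittleO (Asymptotics.IsBigO.of_bound
    (growth c ‖v‖ * (c * growth c ‖v‖ ^ 2 * ‖v‖)) (Eventually.of_forall fun x' => ?_))
    (Asymptotics.isLittleO_pow_sub_sub x one_lt_two)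
  refine (norm_flow_sub_sub_le h v x x' ht).trans (le_of_eq ?_)
  rw [norm_pow, norm_norm]
  ring

theorem fderiv_flow (h : FieldBounds n V c) (v : TimeL2 V) (x : Euc n) :
    fderiv ℝ (flow v 1) x = linearizedFlow h v x 1 :=
  (hasFDerivAt_flow h v x (right_mem_Icc.mpr zero_le_one)).fderiv

/-- If `dφ₁ k = 0`, the curve `p` solves a linear equation with final value `0`, so Grönwall in
reversed time gives `p = 0` and hence `k = p 0 = 0`. Without injectivity `OrientedGrassmannian.map`
would take its default value. -/
theorem injective_fderiv_flow (h : FieldBounds n V c) (v : TimeL2 V) (x : Euc n) :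
    Function.Injective (fderiv ℝ (flow v 1) x) := by
  rw [fderiv_flow h, injective_iff_map_eq_zero]
  intro k hk
  have hy := isSolution_flow h v x
  have h0 : (0 : ℝ) ∈ Icc (0 : ℝ) 1 := left_mem_Icc.mpr zero_le_one
  have h1 : (1 : ℝ) ∈ Icc (0 : ℝ) 1 := right_mem_Icc.mpr zero_le_one
  let p (s : ℝ) : Euc n := linearizedFlow h v x s k
  have hp : ContinuousOn p (Icc 0 1) :=
    (isSolution_linearizedFlow h v x).continuousOn.clm_apply continuousOn_const
  have hG := continuousOn_derivFieldAlong h hy.continuousOn hp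
  have hsub (t : ℝ) (ht : t ∈ Icc (0 : ℝ) 1) :
      ‖p t‖ ^ 2 ≤ (c * ‖v‖) ^ 2 * ∫ s in t..1, ‖p s‖ ^ 2 := by
    have e : p t = -∫ s in t..1, derivFieldAlong h (flow v s x) (p s) (v s) := by
      have e₁ := linearizedFlow_apply h v x k h1
      have e₂ := linearizedFlow_apply h v x k ht
      have e₃ := intervalIntegral.integral_add_adjacent_intervals
        (intervalIntegrable_of_integrable_Icc (integrable_clm_apply hG v) h0 ht)
        (intervalIntegrable_of_integrable_Icc (integrable_clm_apply hG v) ht h1)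
      rw [hk, ← e₃, ← add_assoc, ← e₂] at e₁
      exact eq_neg_of_add_eq_zero_left e₁.symm
    calc ‖p t‖ ^ 2 ≤ (∫ s in t..1, ‖v s‖ * (c * ‖p s‖)) ^ 2 := by
          rw [e, norm_neg]
          gcongr
          exact norm_integral_clm_apply_le v (hp.norm.const_mul c)
            (fun s _ => norm_derivFieldAlong_le h _ _) ht.1 ht.2 le_rfl
      _ ≤ ‖v‖ ^ 2 * ∫ s in t..1, (c * ‖p s‖) ^ 2 :=
          sq_integral_norm_mul_le v (hp.norm.const_mul c) ht.1 ht.2 le_rfl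
      _ = _ := by
          simp only [mul_pow, intervalIntegral.integral_const_mul]
          ring
  -- Time reversal turns the bound by an integral over `[t, 1]` into one over `[0, t]`.
  have hrefl : MapsTo (fun t : ℝ => 1 - t) (Icc 0 1) (Icc 0 1) := fun t ht =>
    ⟨by linarith [ht.2], by linarith [ht.1]⟩
  have := le_of_le_add_mul_integral (w := fun t => ‖p (1 - t)‖ ^ 2) (k := fun _ => 0)
    (sq_nonneg (c * ‖v‖)) ((hp.comp (by fun_prop) hrefl).norm.pow 2) continuousOn_const
    (fun _ _ => le_rfl) (fun t ht => by
      rw [zero_add, intervalIntegral.integral_comp_sub_left (fun s => ‖p s‖ ^ 2), sub_zero]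
      exact hsub _ (hrefl ht)) 1 h1
  have hp0 : p 0 = k := by simp [p, linearizedFlow_apply h v x k h0]
  simp only [sub_self, intervalIntegral.integral_zero, mul_zero, add_zero, hp0] at this
  simpa using this.antisymm (sq_nonneg _)

theorem norm_fderiv_flow_le (h : FieldBounds n V c) {v : TimeL2 V} {M : ℝ} (hM : ‖v‖ ≤ M)
    (x : Euc n) : ‖fderiv ℝ (flow v 1) x‖ ≤ growth c M := by
  rw [fderiv_flow h]
  exact norm_linearizedFlow_le h hM x (right_mem_Icc.mpr zero_le_one)

/-! ### Continuity of the flow and its differential under weak convergence of controls -/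

section Convergence

variable {v' : ℕ → TimeL2 V} {v : TimeL2 V} {x' : ℕ → Euc n} {x : Euc n} {M : ℝ}

theorem tendsto_flow (h : FieldBounds n V c) (hM : ∀ n, ‖v' n‖ ≤ M) (hv : WeakTendsto v' v)
    (hx : Tendsto x' atTop (𝓝 x)) {t : ℝ} (ht : t ∈ Icc (0 : ℝ) 1) :
    Tendsto (fun n => flow (v' n) t (x' n)) atTop (𝓝 (flow v t x)) :=
  -- The field is the same for every index, so its variation is zero.
  (isSolution_flow h v x).tendsto (D := 0) (isLipschitzField_evalField h)
    (fun _ => isLipschitzField_evalField h) (fun n => isSolution_flow h (v' n) (x' n)) hM hx hv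
    (fun _ _ _ => by simp) (fun _ _ => by simp) ht

/-- Here the fields vary, being linearized along different trajectories. They converge because the
trajectories do (`tendsto_flow`) and `derivField` is continuous; `D` comes from the bounds `c` on
each `derivField` and `growth c ‖v‖` on the limit solution. -/
theorem tendsto_fderiv_flow (h : FieldBounds n V c) (hM : ∀ n, ‖v' n‖ ≤ M)
    (hv : WeakTendsto v' v) (hx : Tendsto x' atTop (𝓝 x)) :
    Tendsto (fun n => fderiv ℝ (flow (v' n) 1) (x' n)) atTop (𝓝 (fderiv ℝ (flow v 1) x)) := by
  simp only [fderiv_flow h]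
  refine (isSolution_linearizedFlow h v x).tendsto (D := 2 * c * growth c ‖v‖)
    (isLipschitzField_linearizedField h (isSolution_flow h v x).continuousOn)
    (fun n => isLipschitzField_linearizedField h (isSolution_flow h (v' n) (x' n)).continuousOn)
    (fun n => isSolution_linearizedFlow h (v' n) (x' n)) hM tendsto_const_nhds hv
    (fun n s hs => ?_) (fun s hs => ?_) (right_mem_Icc.mpr zero_le_one)
  · refine (norm_linearizedField_sub_le h _ _ _ _).trans ?_
    have := h.nonneg
    refine mul_le_mul ?_ (norm_linearizedFlow_le h le_rfl x hs) (norm_nonneg _) (by positivity)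
    refine (norm_sub_le (derivField h (flow (v' n) s (x' n)))
      (derivField h (flow v s x))).trans ?_
    linarith [norm_derivField_le h (flow (v' n) s (x' n)), norm_derivField_le h (flow v s x)]
  · refine squeeze_zero (fun _ => norm_nonneg _)
      (fun n => norm_linearizedField_sub_le h _ _ _ _) ?_
    have := ((continuous_derivField h).tendsto _).comp (tendsto_flow h hM hv hx hs)
    have := (tendsto_iff_norm_sub_tendsto_zero (E := V →L[ℝ] Euc n →L[ℝ] Euc n)).mp this
    simpa using this.mul_const ‖linearizedFlow h v x s‖

theorem continuous_flow (h : FieldBounds n V c) (v : TimeL2 V) : Continuous (flow v 1) :=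
  continuous_iff_continuousAt.mpr fun x =>
    (hasFDerivAt_flow h v x (right_mem_Icc.mpr zero_le_one)).continuousAt

/-- The case of a constant sequence of controls, with moving base points. -/
theorem continuous_fderiv_flow (h : FieldBounds n V c) (v : TimeL2 V) :
    Continuous (fderiv ℝ (flow v 1)) :=
  SeqContinuous.continuous fun _ _ hx =>
    tendsto_fderiv_flow h (fun _ => le_rfl) (WeakTendsto.const v) hx

end Convergence

end Flow

/-! ### Topology of the oriented Grassmannian -/

section Grassmannian

variable {n d : ℕ}

theorem det_gram_pos (u : Frame n d) : 0 < (Matrix.gram ℝ u.1).det :=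
  (Matrix.posDef_gram_of_linearIndependent u.2).det_pos

theorem Frame.continuous_apply (i : Fin d) : Continuous fun u : Frame n d => u.1 i :=
  (_root_.continuous_apply i).comp continuous_subtype_val

/-- The frame obtained from `u` by a change of basis. -/
def Frame.change (A : Matrix (Fin d) (Fin d) ℝ) (hA : A.det ≠ 0) (u : Frame n d) : Frame n d :=
  ⟨fun i => ∑ j, A i j • u.1 j, Matrix.linearIndependent_of_det_gram_ne_zero (𝕜 := ℝ) (by
    rw [det_gram_change A u.1 _ fun _ => rfl]
    exact mul_ne_zero (pow_ne_zero 2 hA) (det_gram_pos u).ne')⟩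

theorem Frame.continuous_change (A : Matrix (Fin d) (Fin d) ℝ) (hA : A.det ≠ 0) :
    Continuous (Frame.change (n := n) A hA) :=
  Continuous.subtype_mk (continuous_pi fun i => continuous_finsetSum _ fun j _ =>
    (Frame.continuous_apply j).const_smul (A i j)) _

theorem isQuotientMap_orientedSpan : IsQuotientMap (orientedSpan (n := n) (d := d)) :=
  isQuotientMap_quotient_mk'

/-- The saturation of an open set of frames is the union of its preimages under the continuous
changes of basis of positive determinant. -/
theorem isOpenMap_orientedSpan : IsOpenMap (orientedSpan (n := n) (d := d)) := by
  intro s hs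
  rw [← isQuotientMap_orientedSpan.isOpen_preimage]
  have : orientedSpan ⁻¹' (orientedSpan '' s) =
      ⋃ (A : Matrix (Fin d) (Fin d) ℝ) (hA : 0 < A.det), Frame.change A hA.ne' ⁻¹' s := by
    ext w
    simp only [mem_preimage, mem_image, mem_iUnion]
    constructor
    · rintro ⟨u, hu, huw⟩
      obtain ⟨A, hA, h⟩ := Quotient.exact huw.symm
      exact ⟨A, hA, by rwa [show Frame.change A hA.ne' w = u from Subtype.ext (funext h).symm]⟩
    · rintro ⟨A, hA, h⟩
      exact ⟨_, h, (Quotient.sound ⟨A, hA, fun _ => rfl⟩ : orientedSpan w = _).symm⟩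
  rw [this]
  exact isOpen_iUnion fun A => isOpen_iUnion fun hA =>
    hs.preimage (Frame.continuous_change A hA.ne')

theorem isOpenQuotientMap_orientedSpan : IsOpenQuotientMap (orientedSpan (n := n) (d := d)) :=
  .of_isOpenMap_isQuotientMap isOpenMap_orientedSpan isQuotientMap_orientedSpan

/-- Ensures that open sets of the product with `ℝⁿ` are measurable for the product σ-algebra, hence
that continuous test functions are measurable. -/
instance : SecondCountableTopology (OrientedGrassmannian n d) :=
  isQuotientMap_orientedSpan.secondCountableTopology isOpenMap_orientedSpan

/-- Injective linear maps. -/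
abbrev InjectiveMap (n : ℕ) : Type := {L : Euc n →L[ℝ] Euc n // Function.Injective L}

/-- Continuity is checked on frames, where the action is evaluation. This is legitimate because the
projection is open, so its product with the identity is still a quotient map. -/
theorem continuous_orientedMap :
    Continuous fun p : InjectiveMap n × OrientedGrassmannian n d => p.2.map p.1.1 := by
  rw [← (IsOpenQuotientMap.id.prodMap isOpenQuotientMap_orientedSpan).continuous_comp_iff]
  have : (fun p : InjectiveMap n × OrientedGrassmannian n d => p.2.map p.1.1) ∘
      Prod.map id orientedSpan = fun p => orientedSpan (p.2.map p.1.1 p.1.2) :=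
    funext fun p => OrientedGrassmannian.map_orientedSpan p.1.1 p.1.2 p.2
  rw [this]
  exact isQuotientMap_orientedSpan.continuous.comp (Continuous.subtype_mk
    (continuous_pi fun i => (continuous_subtype_val.comp continuous_fst).clm_apply
      ((Frame.continuous_apply i).comp continuous_snd)) _)

theorem jacobianAlong_orientedSpan (L : Euc n →L[ℝ] Euc n) (u : Frame n d) :
    jacobianAlong L (orientedSpan u) =
      √(Matrix.gram ℝ (fun i => L (u.1 i))).det / √(Matrix.gram ℝ u.1).det := rfl

theorem continuous_jacobianAlong :
    Continuous fun p : (Euc n →L[ℝ] Euc n) × OrientedGrassmannian n d =>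
      jacobianAlong p.1 p.2 := by
  rw [← (IsOpenQuotientMap.id.prodMap isOpenQuotientMap_orientedSpan).continuous_comp_iff]
  have : (fun p : (Euc n →L[ℝ] Euc n) × OrientedGrassmannian n d => jacobianAlong p.1 p.2) ∘
      Prod.map id orientedSpan = fun p =>
        √(Matrix.gram ℝ (fun i => p.1 (p.2.1 i))).det / √(Matrix.gram ℝ p.2.1).det := rfl
  rw [this]
  refine Continuous.div ?_ ?_ fun p => (Real.sqrt_pos.mpr (det_gram_pos p.2)).ne'
  · refine (Continuous.matrix_det (continuous_matrix fun i j => ?_)).sqrt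
    have h (i : Fin d) : Continuous fun p : (Euc n →L[ℝ] Euc n) × Frame n d => p.1 (p.2.1 i) :=
      continuous_fst.clm_apply ((Frame.continuous_apply i).comp continuous_snd)
    exact (h i).inner (h j)
  · refine (Continuous.matrix_det (continuous_matrix fun i j => ?_)).sqrt
    have h (i : Fin d) : Continuous fun p : (Euc n →L[ℝ] Euc n) × Frame n d => p.2.1 i :=
      (Frame.continuous_apply i).comp continuous_snd
    exact (h i).inner (h j)

theorem tendsto_orientedMap {ι : Type*} {l : Filter ι} {L' : ι → Euc n →L[ℝ] Euc n}
    {L : Euc n →L[ℝ] Euc n} (hL' : ∀ i, Function.Injective (L' i)) (hL : Function.Injective L)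
    {U' : ι → OrientedGrassmannian n d} {U : OrientedGrassmannian n d}
    (h : Tendsto L' l (𝓝 L)) (hU : Tendsto U' l (𝓝 U)) :
    Tendsto (fun i => (U' i).map (L' i)) l (𝓝 (U.map L)) := by
  have h1 := (continuous_orientedMap (n := n) (d := d)).tendsto (⟨L, hL⟩, U)
  have h2 : Tendsto (fun i => (⟨L' i, hL' i⟩ : InjectiveMap n)) l (𝓝 ⟨L, hL⟩) :=
    tendsto_subtype_rng.mpr h
  exact h1.comp (h2.prodMk_nhds hU)

theorem tendsto_jacobianAlong {ι : Type*} {l : Filter ι} {L' : ι → Euc n →L[ℝ] Euc n}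
    {L : Euc n →L[ℝ] Euc n} {U' : ι → OrientedGrassmannian n d} {U : OrientedGrassmannian n d}
    (h : Tendsto L' l (𝓝 L)) (hU : Tendsto U' l (𝓝 U)) :
    Tendsto (fun i => jacobianAlong (L' i) (U' i)) l (𝓝 (jacobianAlong L U)) := by
  have h1 := (continuous_jacobianAlong (n := n) (d := d)).tendsto (L, U)
  have h2 := h1.comp (h.prodMk_nhds hU)
  simpa only [Function.comp_def] using h2

theorem jacobianAlong_nonneg (L : Euc n →L[ℝ] Euc n) (U : OrientedGrassmannian n d) :
    0 ≤ jacobianAlong L U := by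
  obtain ⟨u, rfl⟩ := isQuotientMap_orientedSpan.surjective U
  rw [jacobianAlong_orientedSpan]
  positivity

open Nat in
-- In an orthonormal basis of the subspace all Gram entries of the image are at most `C²`, and the
-- Leibniz formula bounds the determinant. Only `A.det ^ 2` enters the change of basis, so the
-- orientation of that basis is irrelevant.
theorem jacobianAlong_le {L : Euc n →L[ℝ] Euc n} {C : ℝ} (hL : ‖L‖ ≤ C)
    (U : OrientedGrassmannian n d) : jacobianAlong L U ≤ √(d ! * (C ^ 2) ^ d) := by
  obtain ⟨u, rfl⟩ := isQuotientMap_orientedSpan.surjective U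
  let w : Fin d → Euc n := InnerProductSpace.gramSchmidtNormed ℝ u.1
  have hw : Orthonormal ℝ w := InnerProductSpace.gramSchmidtNormed_orthonormal u.2
  have hspan : ∀ i, ∃ a : Fin d → ℝ, ∑ j, a j • w j = u.1 i := fun i => by
    rw [← Submodule.mem_span_range_iff_exists_fun, InnerProductSpace.span_gramSchmidtNormed_range,
      InnerProductSpace.span_gramSchmidt]
    exact Submodule.subset_span (mem_range_self i)
  choose A hA using hspan
  have e₁ := det_gram_change (Matrix.of A) w u.1 fun i => (hA i).symm
  have e₂ := det_gram_change (Matrix.of A) (fun i => L (w i)) (fun i => L (u.1 i)) fun i => by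
    simp [← hA i]
  rw [Matrix.gram_eq_one_iff_orthonormal.mpr hw, Matrix.det_one, mul_one] at e₁
  have hpos := det_gram_pos u
  rw [e₁] at hpos
  rw [jacobianAlong_orientedSpan, e₁, e₂, Real.sqrt_mul hpos.le,
    mul_div_cancel_left₀ _ (Real.sqrt_pos.mpr hpos).ne']
  refine Real.sqrt_le_sqrt ((le_abs_self _).trans ?_)
  have hentry (i j : Fin d) :
      AbsoluteValue.abs (Matrix.gram ℝ (fun i => L (w i)) i j) ≤ C ^ 2 := by
    have hi (i : Fin d) : ‖L (w i)‖ ≤ C := by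
      simpa [hw.1 i] using L.le_of_opNorm_le hL (w i)
    rw [Matrix.gram_apply, sq]
    exact (abs_real_inner_le_norm _ _).trans
      (mul_le_mul (hi i) (hi j) (norm_nonneg _) ((norm_nonneg _).trans (hi i)))
  have := Matrix.det_le hentry
  simpa using this

end Grassmannian

/-! ### Transported test functions -/

section Transport

variable {n d : ℕ} {V : Type*} [NormedAddCommGroup V] [InnerProductSpace ℝ V]
  [RKHS ℝ V (Euc n) (Euc n)] {c : ℝ}

/-- The test function whose integral is the pairing of `ω` with the varifold transported by the flow
of `v`. -/
noncomputable def transported (v : TimeL2 V) (ω : Euc n × OrientedGrassmannian n d → ℝ)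
    (p : Euc n × OrientedGrassmannian n d) : ℝ :=
  ω (flow v 1 p.1, p.2.map (fderiv ℝ (flow v 1) p.1)) *
    jacobianAlong (fderiv ℝ (flow v 1) p.1) p.2

theorem continuous_transported (h : FieldBounds n V c) (v : TimeL2 V)
    {ω : Euc n × OrientedGrassmannian n d → ℝ} (hω : Continuous ω) :
    Continuous (transported v ω) := by
  refine continuous_iff_continuousAt.mpr fun p => ?_
  have hx : Tendsto Prod.fst (𝓝 p) (𝓝 p.1) := continuous_fst.tendsto p
  have hU : Tendsto Prod.snd (𝓝 p) (𝓝 p.2) := continuous_snd.tendsto p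
  have hφ := ((continuous_flow h v).tendsto p.1).comp hx
  have hD := ((continuous_fderiv_flow h v).tendsto p.1).comp hx
  have hm := tendsto_orientedMap (fun _ => injective_fderiv_flow h v _) (injective_fderiv_flow h v p.1)
    hD hU
  have := ((hω.tendsto _).comp (hφ.prodMk_nhds hm)).mul (tendsto_jacobianAlong hD hU)
  change Tendsto (fun q => transported v ω q) (𝓝 p) (𝓝 (transported v ω p))
  simpa only [Function.comp_def, transported] using this

open Nat in
theorem abs_transported_le (h : FieldBounds n V c) {v : TimeL2 V} {M : ℝ} (hM : ‖v‖ ≤ M)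
    {ω : Euc n × OrientedGrassmannian n d → ℝ} {C : ℝ} (hω : ∀ p, |ω p| ≤ C)
    (p : Euc n × OrientedGrassmannian n d) :
    |transported v ω p| ≤ C * √(d ! * (growth c M ^ 2) ^ d) := by
  rw [transported, abs_mul, abs_of_nonneg (jacobianAlong_nonneg _ _)]
  exact mul_le_mul (hω _) (jacobianAlong_le (norm_fderiv_flow_le h hM _) _)
    (jacobianAlong_nonneg _ _) ((abs_nonneg _).trans (hω p))

theorem tendsto_transported (h : FieldBounds n V c) {v' : ℕ → TimeL2 V} {v : TimeL2 V} {M : ℝ}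
    (hM : ∀ n, ‖v' n‖ ≤ M) (hv : WeakTendsto v' v) {ω : Euc n × OrientedGrassmannian n d → ℝ}
    (hω : Continuous ω) (p : Euc n × OrientedGrassmannian n d) :
    Tendsto (fun n => transported (v' n) ω p) atTop (𝓝 (transported v ω p)) := by
  have hφ := tendsto_flow h hM hv (tendsto_const_nhds (x := p.1)) (right_mem_Icc.mpr zero_le_one)
  have hD := tendsto_fderiv_flow h hM hv (tendsto_const_nhds (x := p.1))
  have hm := tendsto_orientedMap (fun n => injective_fderiv_flow h (v' n) p.1)
    (injective_fderiv_flow h v p.1) hD (tendsto_const_nhds (x := p.2))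
  have := ((hω.tendsto _).comp (hφ.prodMk_nhds hm)).mul
    (tendsto_jacobianAlong hD (tendsto_const_nhds (x := p.2)))
  simpa only [Function.comp_def, transported] using this

end Transport

/-! ### Pairings with weights on a marginal -/

section Pairing

variable {X Y : Type*} [MeasurableSpace X] [MeasurableSpace Y] {μ : Measure (X × Y)}
  [IsFiniteMeasure μ]

theorem integrable_comp_fst (α : Lp ℝ 2 μ.fst) : Integrable (fun p => α p.1) μ :=
  ((Lp.memLp α).integrable one_le_two).comp_measurable measurable_fst

theorem norm_integral_comp_fst_mul_le (α : Lp ℝ 2 μ.fst) {f : X × Y → ℝ} {C : ℝ}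
    (hC : ∀ p, |f p| ≤ C) : |∫ p, α p.1 * f p ∂μ| ≤ C * ∫ p, |α p.1| ∂μ := by
  rw [← integral_const_mul]
  rw [← Real.norm_eq_abs]
  refine norm_integral_le_of_norm_le ((integrable_comp_fst α).abs.const_mul C)
    (Eventually.of_forall fun p => ?_)
  rw [Real.norm_eq_abs, abs_mul, mul_comm]
  exact mul_le_mul_of_nonneg_right (hC p) (abs_nonneg _)

/-- A weak limit paired with a strong one: `f'` converges in `L²(μ)` by dominated convergence, and
composition with the projection is an isometry `J` from `L²(|μ|)` to `L²(μ)`, hence preserves weak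
limits. -/
theorem tendsto_integral_comp_fst_mul {α' : ℕ → Lp ℝ 2 μ.fst} {α : Lp ℝ 2 μ.fst} {M : ℝ}
    (hM : ∀ n, ‖α' n‖ ≤ M) (hα : WeakTendsto α' α) {f' : ℕ → X × Y → ℝ} {f : X × Y → ℝ} {C : ℝ}
    (hf' : ∀ n, AEStronglyMeasurable (f' n) μ) (hf : AEStronglyMeasurable f μ)
    (hC' : ∀ n p, |f' n p| ≤ C) (hC : ∀ p, |f p| ≤ C)
    (hff : ∀ p, Tendsto (fun n => f' n p) atTop (𝓝 (f p))) :
    Tendsto (fun n => ∫ p, α' n p.1 * f' n p ∂μ) atTop (𝓝 (∫ p, α p.1 * f p ∂μ)) := by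
  have hfst : MeasurePreserving Prod.fst μ μ.fst := ⟨measurable_fst, rfl⟩
  let J : Lp ℝ 2 μ.fst →ₗᵢ[ℝ] Lp ℝ 2 μ := Lp.compMeasurePreservingₗᵢ ℝ Prod.fst hfst
  have hm' (n : ℕ) : MemLp (f' n) 2 μ := MemLp.of_bound (hf' n) C (Eventually.of_forall (hC' n))
  have hm : MemLp f 2 μ := MemLp.of_bound hf C (Eventually.of_forall hC)
  have key (β : Lp ℝ 2 μ.fst) (g : X × Y → ℝ) (hg : MemLp g 2 μ) :
      ∫ p, β p.1 * g p ∂μ = inner ℝ (hg.toLp g) (J β) := by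
    rw [L2.inner_def]
    refine integral_congr_ae ?_
    filter_upwards [hg.coeFn_toLp, Lp.coeFn_compMeasurePreserving β hfst] with p h1 h2
    have h3 : (J β) p = β p.1 := h2
    rw [h1, h3]
    rfl
  have hF : Tendsto (fun n => ‖(hm' n).toLp (f' n) - hm.toLp f‖ ^ 2) atTop (𝓝 0) := by
    have h1 : Tendsto (fun n => ∫ p, ‖f' n p - f p‖ ^ 2 ∂μ) atTop (𝓝 (∫ _, (0 : ℝ) ∂μ)) := by
      refine tendsto_integral_of_dominated_convergence (fun _ => (C + C) ^ 2)
        (fun n => ((hf' n).sub hf).norm.pow 2) (integrable_const _)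
        (fun n => Eventually.of_forall fun p => ?_) (Eventually.of_forall fun p => ?_)
      · rw [norm_pow, norm_norm]
        gcongr
        exact (norm_sub_le _ _).trans (add_le_add (hC' n p) (hC p))
      · have := tendsto_iff_norm_sub_tendsto_zero.mp (hff p)
        simpa using this.pow 2
    rw [integral_zero] at h1
    refine h1.congr fun n => ?_
    rw [← MemLp.toLp_sub, ← integral_norm_sq_eq]
    refine integral_congr_ae ?_
    filter_upwards [((hm' n).sub hm).coeFn_toLp] with p hp
    rw [hp, Pi.sub_apply]
  have hF' : Tendsto (fun n => ‖(hm' n).toLp (f' n) - hm.toLp f‖ * M) atTop (𝓝 0) := by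
    simpa using hF.sqrt.mul_const M
  have h1 : Tendsto (fun n => inner ℝ ((hm' n).toLp (f' n) - hm.toLp f) (J (α' n))) atTop
      (𝓝 0) := by
    refine squeeze_zero_norm (fun n => (norm_inner_le_norm _ _).trans ?_) hF'
    rw [J.norm_map]
    exact mul_le_mul_of_nonneg_left (hM n) (norm_nonneg _)
  have h2 : Tendsto (fun n => inner ℝ (hm.toLp f) (J (α' n))) atTop
      (𝓝 (inner ℝ (hm.toLp f) (J α))) :=
    hα ((innerSL ℝ (hm.toLp f)).comp J.toContinuousLinearMap)
  have h3 := h1.add h2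
  rw [zero_add] at h3
  rw [key α f hm]
  refine h3.congr fun n => ?_
  rw [key (α' n) (f' n) (hm' n), inner_sub_left, sub_add_cancel]

/-- Testing against the negative part of the limit gives a nonnegative number, which also equals
minus the square of its norm. -/
theorem nonneg_of_weakTendsto {ν : Measure X} {α' : ℕ → Lp ℝ 2 ν} {α : Lp ℝ 2 ν}
    (hα : WeakTendsto α' α) (h0 : ∀ n, 0 ≤ α' n) : 0 ≤ α := by
  have hneg := Lp.coeFn_negPart α
  have h1 (n : ℕ) : 0 ≤ inner ℝ (Lp.negPart α) (α' n) := by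
    rw [L2.inner_def]
    refine integral_nonneg_of_ae ?_
    filter_upwards [hneg, (Lp.coeFn_nonneg _).mpr (h0 n)] with x hx hx'
    rw [hx]
    exact mul_nonneg hx' (neg_nonneg.mpr (min_le_right _ _))
  have h2 : 0 ≤ inner ℝ (Lp.negPart α) α :=
    ge_of_tendsto' (hα (innerSL ℝ (Lp.negPart α))) h1
  have h3 : inner ℝ (Lp.negPart α) α = -‖Lp.negPart α‖ ^ 2 := by
    rw [L2.inner_def, ← integral_norm_sq_eq, ← integral_neg]
    refine integral_congr_ae ?_
    filter_upwards [hneg] with x hx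
    rw [hx, real_inner_eq_re_inner, norm_neg, Real.norm_eq_abs, sq_abs]
    rcases le_total (α x) 0 with h | h
    · simp [min_eq_left h, sq]
    · simp [min_eq_right h]
  have h4 : Lp.negPart α = 0 := by
    rw [← norm_eq_zero]
    nlinarith [norm_nonneg (Lp.negPart α)]
  rw [← Lp.coeFn_nonneg]
  filter_upwards [hneg, Lp.coeFn_zero ℝ 2 ν] with x hx hx'
  rw [h4, hx'] at hx
  have : min (α x) 0 = 0 := by simpa using hx
  simpa using this

end Pairing

/-! ### The relaxed energy -/

section Energy

variable {n d : ℕ} {V : Type*} [NormedAddCommGroup V] [InnerProductSpace ℝ V]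
  [RKHS ℝ V (Euc n) (Euc n)]
  {W : Type*} [NormedAddCommGroup W] [InnerProductSpace ℝ W]
  [RKHS ℝ W (Euc n × OrientedGrassmannian n d) ℝ] {c : ℝ} {γ lam : ℝ}
  {μ μ' : Measure (Euc n × OrientedGrassmannian n d)}

theorem EmbedsInC01.continuous (hW : EmbedsInC01 n d W) (ω : W) : Continuous ⇑ω := by
  obtain ⟨_, hc⟩ := hW
  obtain ⟨f, hf⟩ := (hc ω).1.zero_at_infty
  rw [← hf]
  exact f.continuous

theorem EmbedsInC01.exists_bound (hW : EmbedsInC01 n d W) :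
    ∃ C, ∀ ω : W, ‖ω‖ ≤ 1 → ∀ p, |ω p| ≤ C := by
  obtain ⟨c, hc⟩ := hW
  refine ⟨max c 0, fun ω hω p => ((hc ω).2.1 p).trans ?_⟩
  calc c * ‖ω‖ ≤ max c 0 * ‖ω‖ := by
        gcongr
        exact le_max_left _ _
    _ ≤ max c 0 := mul_le_of_le_one_right (le_max_right _ _) hω

/-- The defect of the transported and reweighted varifold from the target. -/
noncomputable def defect (μ μ' : Measure (Euc n × OrientedGrassmannian n d)) (v : TimeL2 V)
    (α : Lp ℝ 2 μ.fst) : Distr n d :=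
  pushforward (flow v 1) (rescale α μ) - toDistr μ'

theorem defect_apply (v : TimeL2 V) (α : Lp ℝ 2 μ.fst)
    (ω : Euc n × OrientedGrassmannian n d → ℝ) :
    defect μ μ' v α ω = (∫ p, α p.1 * transported v ω p ∂μ) - ∫ p, ω p ∂μ' := rfl

/-- The tangent minorant of the squared norm at `y`, with equality at `x = y`. It is affine in `x`,
so it passes to weak limits; this is the source of lower semicontinuity. -/
theorem two_mul_inner_sub_le {H : Type*} [NormedAddCommGroup H] [InnerProductSpace ℝ H]
    (x y : H) : 2 * inner ℝ y x - ‖y‖ ^ 2 ≤ ‖x‖ ^ 2 := by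
  have := norm_sub_sq_real x y
  rw [real_inner_comm] at this
  nlinarith [sq_nonneg ‖x - y‖]

theorem defect_zero (v : TimeL2 V) (α : Lp ℝ 2 μ.fst) : defect μ μ' v α 0 = 0 := by
  simp [defect_apply, transported]

theorem dualNorm_defect_le {v : TimeL2 V} {α : Lp ℝ 2 μ.fst} {r : ℝ}
    (hr : ∀ ω : W, ‖ω‖ ≤ 1 → defect μ μ' v α ω ≤ r) : dualNorm W (defect μ μ' v α) ≤ r := by
  refine csSup_le ⟨_, 0, by simp, rfl⟩ ?_
  rintro _ ⟨ω, hω, rfl⟩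
  exact hr ω hω

variable [IsFiniteMeasure μ]

/-- Convergence on each fixed `ω` is enough, since lower semicontinuity of a supremum needs no
uniformity. -/
theorem tendsto_defect (h : FieldBounds n V c) (hW : EmbedsInC01 n d W)
    {v' : ℕ → TimeL2 V} {v : TimeL2 V} {M : ℝ} (hM : ∀ n, ‖v' n‖ ≤ M) (hv : WeakTendsto v' v)
    {α' : ℕ → Lp ℝ 2 μ.fst} {α : Lp ℝ 2 μ.fst} {M' : ℝ} (hM' : ∀ n, ‖α' n‖ ≤ M')
    (hα : WeakTendsto α' α) {ω : W} (hω : ‖ω‖ ≤ 1) :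
    Tendsto (fun n => defect μ μ' (v' n) (α' n) ω) atTop (𝓝 (defect μ μ' v α ω)) := by
  obtain ⟨C, hC⟩ := hW.exists_bound
  have hωc := hW.continuous ω
  have hb (n : ℕ) : ‖v' n‖ ≤ max M ‖v‖ := (hM n).trans (le_max_left _ _)
  simp only [defect_apply]
  exact (tendsto_integral_comp_fst_mul hM' hα
    (fun n => (continuous_transported h (v' n) hωc).aestronglyMeasurable)
    (continuous_transported h v hωc).aestronglyMeasurable
    (fun n => abs_transported_le h (hb n) (hC ω hω))
    (abs_transported_le h (le_max_right M ‖v‖) (hC ω hω))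
    (tendsto_transported h hM hv hωc)).sub_const _

/-- The constant weight `1`. -/
noncomputable def unitWeight (μ : Measure (Euc n × OrientedGrassmannian n d)) [IsFiniteMeasure μ] :
    Lp ℝ 2 μ.fst :=
  (memLp_const (1 : ℝ)).toLp fun _ => (1 : ℝ)

/-- The weighted sum of the kinetic energy, of the deviation of the weights from `1`, and of the
squared dual norm of the defect. -/
noncomputable def weightedEnergy (W : Type*) [NormedAddCommGroup W] [InnerProductSpace ℝ W]
    [RKHS ℝ W (Euc n × OrientedGrassmannian n d) ℝ] (γ lam : ℝ)
    (μ μ' : Measure (Euc n × OrientedGrassmannian n d)) [IsFiniteMeasure μ]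
    (q : TimeL2 V × Lp ℝ 2 μ.fst) : ℝ :=
  1 / 2 * ‖q.1‖ ^ 2 + γ / 2 * ‖q.2 - unitWeight μ‖ ^ 2 +
    lam / 2 * dualNorm W (defect μ μ' q.1 q.2) ^ 2

/-- The integral over `[0, 1]` in `relaxedEnergy` extends over the last two terms, so that these
enter with the factors `γ / 4` and `lam / 4`. -/
theorem relaxedEnergy_eq_weightedEnergy :
    relaxedEnergy (V := V) W γ lam μ μ' = weightedEnergy W (γ / 2) (lam / 2) μ μ' := by
  funext q
  have h1 : ∫ x, (q.2 x - 1) ^ 2 ∂μ.fst = ‖q.2 - unitWeight μ‖ ^ 2 := by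
    rw [← integral_norm_sq_eq]
    refine integral_congr_ae ?_
    filter_upwards [Lp.coeFn_sub q.2 (unitWeight μ),
      (memLp_const (μ := μ.fst) (p := 2) (1 : ℝ)).coeFn_toLp] with x h1 h2
    rw [h1, Pi.sub_apply, Real.norm_eq_abs, sq_abs, unitWeight, h2]
  have h2 : Integrable (fun t => ‖q.1 t‖ ^ 2) (volume.restrict (Icc (0 : ℝ) 1)) :=
    (Lp.memLp q.1).norm.integrable_sq
  have h3 : volume.real (Icc (0 : ℝ) 1) = 1 := by simp
  have h4 (a b : ℝ) : ∫ t in Icc (0 : ℝ) 1, (‖q.1 t‖ ^ 2 + a + b) = ‖q.1‖ ^ 2 + a + b := by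
    have h5 : ∀ t, ‖q.1 t‖ ^ 2 + a + b = ‖q.1 t‖ ^ 2 + (a + b) := fun t => add_assoc _ _ _
    simp only [h5]
    rw [integral_add h2 (integrable_const _), integral_norm_sq_eq, setIntegral_const, h3,
      one_smul, add_assoc]
  rw [relaxedEnergy, h1, h4, weightedEnergy, defect]
  ring

variable [IsFiniteMeasure μ']

/-- Needed because the real `sSup` of an unbounded set is `0`, in which case the dual norm would not
dominate the pairings. -/
theorem bddAbove_defect (h : FieldBounds n V c) (hW : EmbedsInC01 n d W) (v : TimeL2 V)
    (α : Lp ℝ 2 μ.fst) : BddAbove {r | ∃ ω : W, ‖ω‖ ≤ 1 ∧ r = defect μ μ' v α ω} := by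
  obtain ⟨C, hC⟩ := hW.exists_bound
  refine ⟨C * √(d.factorial * (growth c ‖v‖ ^ 2) ^ d) * (∫ p, |α p.1| ∂μ) +
    C * μ'.real univ, ?_⟩
  rintro _ ⟨ω, hω, rfl⟩
  rw [defect_apply]
  have h1 := norm_integral_comp_fst_mul_le α (abs_transported_le h (le_refl ‖v‖) (hC ω hω))
  have h2 : ‖∫ p, ω p ∂μ'‖ ≤ C * μ'.real univ :=
    norm_integral_le_of_norm_le_const (Eventually.of_forall (hC ω hω))
  linarith [(abs_le.mp h1).2, (abs_le.mp h2).1]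

theorem le_dualNorm_defect (h : FieldBounds n V c) (hW : EmbedsInC01 n d W) (v : TimeL2 V)
    (α : Lp ℝ 2 μ.fst) {ω : W} (hω : ‖ω‖ ≤ 1) :
    defect μ μ' v α ω ≤ dualNorm W (defect μ μ' v α) :=
  le_csSup (bddAbove_defect h hW v α) ⟨ω, hω, rfl⟩

theorem dualNorm_defect_nonneg (h : FieldBounds n V c) (hW : EmbedsInC01 n d W) (v : TimeL2 V)
    (α : Lp ℝ 2 μ.fst) : 0 ≤ dualNorm W (defect μ μ' v α) := by
  have := le_dualNorm_defect (μ' := μ') h hW v α (ω := 0) (by simp)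
  rwa [RKHS.coe_zero, defect_zero] at this

/-- The weighted energy is sequentially weakly lower semicontinuous. -/
theorem weightedEnergy_le_of_weakTendsto (h : FieldBounds n V c) (hW : EmbedsInC01 n d W)
    (hγ : 0 < γ) (hlam : 0 < lam) {v' : ℕ → TimeL2 V} {v : TimeL2 V} {M : ℝ}
    (hM : ∀ n, ‖v' n‖ ≤ M) (hv : WeakTendsto v' v)
    {α' : ℕ → Lp ℝ 2 μ.fst} {α : Lp ℝ 2 μ.fst} {M' : ℝ} (hM' : ∀ n, ‖α' n‖ ≤ M')
    (hα : WeakTendsto α' α) {e : ℝ}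
    (he : Tendsto (fun n => weightedEnergy W γ lam μ μ' (v' n, α' n)) atTop (𝓝 e)) :
    weightedEnergy W γ lam μ μ' (v, α) ≤ e := by
  set D := dualNorm W (defect μ μ' v α) with hDdef
  have hD0 : 0 ≤ D := dualNorm_defect_nonneg h hW v α
  -- Each square is replaced by its tangent minorant at the limit, and the dual norm inside by the
  -- pairing with one `ω`. These minorants converge along the sequence.
  have key (ω : W) (hω : ‖ω‖ ≤ 1) : 1 / 2 * ‖v‖ ^ 2 + γ / 2 * ‖α - unitWeight μ‖ ^ 2 +
      lam / 2 * (2 * (D * defect μ μ' v α ω) - D ^ 2) ≤ e := by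
    have t₁ : Tendsto (fun n => inner ℝ v (v' n)) atTop (𝓝 (inner ℝ v v)) := hv (innerSL ℝ v)
    have t₂ : Tendsto (fun n => inner ℝ (α - unitWeight μ) (α' n)) atTop
        (𝓝 (inner ℝ (α - unitWeight μ) α)) := hα (innerSL ℝ (α - unitWeight μ))
    have t₂' : Tendsto (fun n => inner ℝ (α - unitWeight μ) (α' n - unitWeight μ)) atTop
        (𝓝 (inner ℝ (α - unitWeight μ) (α - unitWeight μ))) := by
      simpa only [inner_sub_right] using t₂.sub_const (inner ℝ (α - unitWeight μ) (unitWeight μ))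
    have t₃ := tendsto_defect (μ' := μ') h hW hM hv hM' hα hω
    have t := (((((t₁.const_mul 2).sub_const (‖v‖ ^ 2)).const_mul (1 / 2)).add
      (((t₂'.const_mul 2).sub_const (‖α - unitWeight μ‖ ^ 2)).const_mul (γ / 2))).add
      ((((t₃.const_mul D).const_mul 2).sub_const (D ^ 2)).const_mul (lam / 2)))
    have hle := le_of_tendsto_of_tendsto' t he fun n => by
      rw [weightedEnergy]
      have h₃ := le_dualNorm_defect (μ' := μ') h hW (v' n) (α' n) hω
      have h₄ : 2 * (D * defect μ μ' (v' n) (α' n) ω) - D ^ 2 ≤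
          dualNorm W (defect μ μ' (v' n) (α' n)) ^ 2 := by
        nlinarith [mul_le_mul_of_nonneg_left h₃ hD0,
          sq_nonneg (D - dualNorm W (defect μ μ' (v' n) (α' n)))]
      gcongr
      · exact two_mul_inner_sub_le _ _
      · exact two_mul_inner_sub_le _ _
    rw [real_inner_self_eq_norm_sq, real_inner_self_eq_norm_sq] at hle
    linarith
  rw [weightedEnergy, ← hDdef]
  rcases hD0.eq_or_lt with h0 | hpos
  · have := key 0 (by simp)
    rw [← h0] at this ⊢
    linarith
  · have hle : D ≤ (e - 1 / 2 * ‖v‖ ^ 2 - γ / 2 * ‖α - unitWeight μ‖ ^ 2 + lam / 2 * D ^ 2) /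
        (lam * D) := by
      refine dualNorm_defect_le fun ω hω => ?_
      rw [le_div_iff₀ (mul_pos hlam hpos)]
      linarith [key ω hω]
    rw [le_div_iff₀ (mul_pos hlam hpos)] at hle
    linarith

/-- The direct method: the weighted energy attains its infimum over every set of the form
`L²([0, 1], V) × A` with `A` nonempty and sequentially weakly closed. -/
theorem exists_isMinOn_weightedEnergy [CompleteSpace V] (h : FieldBounds n V c)
    (hW : EmbedsInC01 n d W) (hγ : 0 < γ) (hlam : 0 < lam) {A : Set (Lp ℝ 2 μ.fst)}
    (hA : A.Nonempty) (hclosed : ∀ α' α, WeakTendsto α' α → (∀ n, α' n ∈ A) → α ∈ A) :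
    ∃ q : TimeL2 V × Lp ℝ 2 μ.fst, q.2 ∈ A ∧
      IsMinOn (weightedEnergy W γ lam μ μ') {q' | q'.2 ∈ A} q := by
  let E : TimeL2 V × Lp ℝ 2 μ.fst → ℝ := weightedEnergy W γ lam μ μ'
  let S : Set (TimeL2 V × Lp ℝ 2 μ.fst) := {q' | q'.2 ∈ A}
  have hne : (E '' S).Nonempty := by
    obtain ⟨α, hα⟩ := hA
    exact ⟨_, (0, α), hα, rfl⟩
  have hbdd : BddBelow (E '' S) := by
    refine ⟨0, ?_⟩
    rintro _ ⟨q, -, rfl⟩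
    change 0 ≤ weightedEnergy W γ lam μ μ' (q.1, q.2)
    rw [weightedEnergy]
    positivity
  obtain ⟨r, -, hr, hrS⟩ := exists_seq_tendsto_sInf hne hbdd
  choose q hqS hqr using hrS
  have hE : Tendsto (fun n => E (q n)) atTop (𝓝 (sInf (E '' S))) := by simpa only [hqr] using hr
  obtain ⟨b, hb⟩ := hE.bddAbove_range
  have hbn (n : ℕ) : 1 / 2 * ‖(q n).1‖ ^ 2 + γ / 2 * ‖(q n).2 - unitWeight μ‖ ^ 2 +
      lam / 2 * dualNorm W (defect μ μ' (q n).1 (q n).2) ^ 2 ≤ b := by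
    rw [← weightedEnergy]
    exact hb (mem_range_self n)
  have hM (n : ℕ) : ‖(q n).1‖ ≤ √(2 * b) := by
    refine Real.le_sqrt_of_sq_le ?_
    have h1 : 0 ≤ γ / 2 * ‖(q n).2 - unitWeight μ‖ ^ 2 := by positivity
    have h2 : 0 ≤ lam / 2 * dualNorm W (defect μ μ' (q n).1 (q n).2) ^ 2 := by positivity
    linarith [hbn n]
  have hM' (n : ℕ) : ‖(q n).2‖ ≤ √(2 * b / γ) + ‖unitWeight μ‖ := by
    have h3 : ‖(q n).2 - unitWeight μ‖ ≤ √(2 * b / γ) := by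
      refine Real.le_sqrt_of_sq_le ?_
      rw [le_div_iff₀ hγ]
      have h1 : 0 ≤ 1 / 2 * ‖(q n).1‖ ^ 2 := by positivity
      have h2 : 0 ≤ lam / 2 * dualNorm W (defect μ μ' (q n).1 (q n).2) ^ 2 := by positivity
      linarith [hbn n]
    calc ‖(q n).2‖ = ‖((q n).2 - unitWeight μ) + unitWeight μ‖ := by rw [sub_add_cancel]
      _ ≤ _ := (norm_add_le _ _).trans (by gcongr)
  -- The subsequence for the weights is extracted from the one already chosen for the controls, so
  -- both converge along `θ ∘ η`.
  obtain ⟨v, θ, hθ, hv⟩ := exists_weakTendsto_subseq hM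
  obtain ⟨α, η, hη, hα⟩ := exists_weakTendsto_subseq fun n => hM' (θ n)
  have hle := weightedEnergy_le_of_weakTendsto (W := W) (μ' := μ') h hW hγ hlam
    (fun n => hM (θ (η n))) (hv.comp_strictMono hη) (fun n => hM' (θ (η n))) hα
    (hE.comp (hθ.comp hη).tendsto_atTop)
  refine ⟨(v, α), hclosed _ _ hα fun n => hqS _, isMinOn_iff.mpr fun q' hq' => ?_⟩
  exact hle.trans (csInf_le hbdd ⟨q', hq', rfl⟩)

end Energy

end VarifoldMetamorphosis

/-! ### Existence of minimizers, unconstrained and with nonnegative weights -/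

theorem mainTheorem4 (n d : ℕ) (hn : 2 ≤ n) (hd : d ≤ n)
    (V : Type*) [NormedAddCommGroup V] [InnerProductSpace ℝ V] [CompleteSpace V]
    [RKHS ℝ V (Euc n) (Euc n)] (hV : EmbedsInC02 n V)
    (k : Euc n × OrientedGrassmannian n d → Euc n × OrientedGrassmannian n d → ℝ)
    (W : Type*) [NormedAddCommGroup W] [InnerProductSpace ℝ W] [CompleteSpace W]
    [RKHS ℝ W (Euc n × OrientedGrassmannian n d) ℝ]
    (hk : IsC0Universal k W) (hW : EmbedsInC01 n d W)
    (γ lam : ℝ) (hγ : 0 < γ) (hlam : 0 < lam)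
    (μ μ' : Measure (Euc n × OrientedGrassmannian n d)) [IsFiniteMeasure μ] [IsFiniteMeasure μ']
    (K : Set (Euc n × OrientedGrassmannian n d)) (hK : IsCompact K) (hμK : μ.support ⊆ K) :
    -- every `v` has a unique flow, so that the functional is the intended one
    (∀ v : TimeL2 V, IsFlow v (flow v) ∧
      ∀ ψ, IsFlow v ψ → ∀ t ∈ Set.Icc (0 : ℝ) 1, ψ t = flow v t) ∧
    -- a minimizer over `L²([0,1], V) × L²(|μ|)`
    (∃ q : TimeL2 V × Lp ℝ 2 μ.fst,
      IsMinOn (relaxedEnergy W γ lam μ μ') Set.univ q) ∧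
    -- the same when the weights are constrained to be nonnegative
    (∃ q : TimeL2 V × Lp ℝ 2 μ.fst, 0 ≤ q.2 ∧
      IsMinOn (relaxedEnergy W γ lam μ μ') {q' | 0 ≤ q'.2} q) := by
  obtain ⟨c, h⟩ := hV.exists_fieldBounds
  refine ⟨fun v => ⟨isFlow_flow h v, fun ψ hψ t ht => hψ.eq_flow h ht⟩, ?_, ?_⟩
  -- The direct method applies to all positive weights, in particular to the halved ones by which
  -- `relaxedEnergy` is a `weightedEnergy`.
  · obtain ⟨q, -, hq⟩ := exists_isMinOn_weightedEnergy (μ := μ) (μ' := μ') h hW (half_pos hγ)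
      (half_pos hlam) (A := Set.univ) Set.univ_nonempty fun _ _ _ _ => Set.mem_univ _
    refine ⟨q, ?_⟩
    rw [relaxedEnergy_eq_weightedEnergy]
    simpa using hq
  · obtain ⟨q, hq0, hq⟩ := exists_isMinOn_weightedEnergy (μ := μ) (μ' := μ') h hW (half_pos hγ)
      (half_pos hlam) (A := {α | 0 ≤ α}) ⟨0, le_refl (0 : Lp ℝ 2 μ.fst)⟩ fun _ _ => nonneg_of_weakTendsto
    refine ⟨q, hq0, ?_⟩
    rw [relaxedEnergy_eq_weightedEnergy]
    exact hq
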